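/- Let $C:[0,\infty)\to\mathbb{R}$ be a stationary isotropic covariance kernel that is valid in all dimensions, i.e. for every dimension $M\ge 1$ there exist $m_M\in\mathbb{R}$ and a Gaussian random function on $\mathbb{R}^M$ with constant mean $m_M$ and covariance function $(x,y)\mapsto\frac1M C\bigl(\frac{\|x-y\|^2}{2}\bigr)$. Let $N\ge 1$, $\mu\in\mathbb{R}$, and let $\mathbf f_N\sim\mathcal N(\mu,C)$, i.e. $\mathbf f_N:\mathbb{R}^N\to\mathbb{R}$ is a Gaussian random function with $$\mathbb{E}[\mathbf f_N(x)]=\mu,\qquad \operatorname{Cov}(\mathbf f_N(x),\mathbf f_N(y))=\tfrac1N C\bigl(\tfrac{\|x-y\|^2}{2}\bigr)\qquad(x,y\in\mathbb{R}^N).$$ Assume that $\mathbf f_N$ has almost surely continuous sample paths and is not almost surely constant. Let $k\in\mathbb{N}_0$ be any order up to which $\mathbf f_N$ is almost surely differentiable, in the sense that almost surely all iterated partial derivatives of the sample path up to order $k$ exist at every point. Then $$\mathbf g=\bigl(\mathbf f_N,\nabla\mathbf f_N,(\partial_{ij}\mathbf f_N)_{i\le j},\dots,(\partial_{i_1\cdots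 i_k}\mathbf f_N)_{i_1\le\dots\le i_k}\bigr)$$ is a square integrable random function that is strictly positive definite: for every $n$, all distinct points $x_1,\dots,x_n\in\mathbb{R}^N$ and all weight vectors $w_1,\dots,w_n$ (with one entry for each component of $\mathbf g$), the equality $$\mathbb{V}\Bigl[\sum_{j=1}^n w_j^T\mathbf g(x_j)\Bigr]=0$$ implies $w_j=0$ for all $j$. -/

import Mathlib

open MeasureTheory ProbabilityTheory
open scoped NNReal

/-- The family `f` of random variables indexed by `ℝᴺ` is a stationary isotropic Gaussian random
function `f ∼ 𝓝(m, C)` on `ℝᴺ` (with the dimensional scaling `1 / N`): all finite-dimensional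
distributions are Gaussian, the mean is the constant `m`, and the covariance of `f x` and `f y`
is `C (‖x - y‖² / 2) / N`. -/
structure IsStationaryIsotropicGRF {Ω : Type*} [MeasurableSpace Ω] (P : Measure Ω) (N : ℕ)
    (m : ℝ) (C : ℝ≥0 → ℝ) (f : EuclideanSpace ℝ (Fin N) → Ω → ℝ) : Prop where
  gaussian : IsGaussianProcess f P
  mean : ∀ x, ∫ ω, f x ω ∂P = m
  cov : ∀ x y, covariance (f x) (f y) P = (1 / (N : ℝ)) * C (‖x - y‖₊ ^ 2 / 2)

/-- The kernel `C` is valid in all dimensions: for every dimension `N ≥ 1` there is a stationary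
isotropic Gaussian random function `f_N ∼ 𝓝(m, C)` on `ℝᴺ`. -/
def ValidInAllDimensions (C : ℝ≥0 → ℝ) : Prop :=
  ∀ N : ℕ, 1 ≤ N → ∃ (Ω : Type) (_ : MeasurableSpace Ω) (P : Measure Ω) (m : ℝ)
    (f : EuclideanSpace ℝ (Fin N) → Ω → ℝ), IsProbabilityMeasure P ∧
      IsStationaryIsotropicGRF P N m C f

/-- A square integrable random function `g : ℝᴺ → ℝ^ι` is strictly positive definite if for
distinct points `x₁, …, xₙ` and weights `w₁, …, wₙ ∈ ℝ^ι` the equality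
`Var[∑ₖ wₖᵀ g(xₖ)] = 0` forces `wₖ = 0` for all `k`. -/
def IsStrictlyPosDef {Ω : Type*} [MeasurableSpace Ω] (P : Measure Ω) {N : ℕ}
    {ι : Type*} [Fintype ι] (g : EuclideanSpace ℝ (Fin N) → Ω → ι → ℝ) : Prop :=
  (∀ x a, MemLp (fun ω => g x ω a) 2 P) ∧
  ∀ (n : ℕ) (x : Fin n → EuclideanSpace ℝ (Fin N)) (w : Fin n → ι → ℝ),
    Function.Injective x →
    variance (fun ω => ∑ j, ∑ a, w j a * g (x j) ω a) P = 0 →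
    ∀ j, w j = 0

/-- The iterated partial derivative `∂_{i₁} (∂_{i₂} (⋯ ∂_{iₗ} φ))` of `φ : ℝᴺ → ℝ`, for the word
`[i₁, …, iₗ]` of coordinate directions. -/
noncomputable def partialDeriv {N : ℕ} :
    List (Fin N) → (EuclideanSpace ℝ (Fin N) → ℝ) → EuclideanSpace ℝ (Fin N) → ℝ
  | [], φ => φ
  | i :: l, φ => fun x => lineDeriv ℝ (partialDeriv l φ) x (EuclideanSpace.single i 1)

/-- All iterated partial derivatives of `φ : ℝᴺ → ℝ` up to order `k` exist at every point. -/
def HasPartialDerivsUpTo {N : ℕ} (k : ℕ) (φ : EuclideanSpace ℝ (Fin N) → ℝ) : Prop :=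
  ∀ l : List (Fin N), l.length < k → ∀ (i : Fin N) (x : EuclideanSpace ℝ (Fin N)),
    LineDifferentiableAt ℝ (partialDeriv l φ) x (EuclideanSpace.single i 1)

/-- The indices of the partial derivatives of order at most `k`, each listed once: an order
`l ≤ k` and a word `i₁ ≤ ⋯ ≤ iₗ` of coordinate directions. -/
abbrev DerivIndex (N k : ℕ) : Type :=
  (l : Fin (k + 1)) × {i : Fin l → Fin N // Monotone i}

noncomputable instance instFintypeDerivIndex (N k : ℕ) : Fintype (DerivIndex N k) := Fintype.ofFinite _

/-- The random function `(f, ∇f, (∂_{ij} f)_{i ≤ j}, …, (∂_{i₁⋯iₖ} f)_{i₁ ≤ ⋯ ≤ iₖ})`. -/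
noncomputable def derivVector {Ω : Type*} {N : ℕ} (k : ℕ)
    (f : EuclideanSpace ℝ (Fin N) → Ω → ℝ) :
    EuclideanSpace ℝ (Fin N) → Ω → DerivIndex N k → ℝ :=
  fun x ω a => partialDeriv (List.ofFn a.2.1) (fun y => f y ω) x

/-! Validity in all dimensions makes `C` a mixture of exponentials (Schoenberg): `C s = C 0 * ∫ t ^
s dν(t)` with `ν` a probability measure on `[0,1]` without mass at `0`. The measure comes from the
Hausdorff moment problem at dyadic arguments, together with continuity of `C`, which is inherited
from the sample paths. Since `t ^ (‖x‖²/2)` is the characteristic function of a centred Gaussian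
with variance `-log t`, the covariance on `ℝᴺ` is the Fourier transform of a finite measure `ρ`. As
`C` is not constant, some of these Gaussians are nondegenerate, so `ρ` has full support.

Sending `f x - m` to the character `z ↦ exp(i⟨z,x⟩)` is then an isometry into `L²(ρ)`. For jointly
Gaussian variables almost sure convergence forces `L²` convergence, so pathwise derivatives are
limits of difference quotients in `L²(P)`, hence also on the spectral side, where they become
multiplication by `i zⱼ`. No moment assumption on `ρ` is needed.

Zero variance therefore says that a sum of polynomials times characters vanishes `ρ`-a.e., and by
full support and continuity everywhere. Characters at distinct points are linearly independent over
the polynomials, and distinct sorted words give distinct monomials, so all weights vanish. -/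

/-! ### The Hausdorff moment problem. -/

open Filter Topology in
-- Convexity makes the increments nondecreasing, so a single positive increment would force linear
-- growth.
theorem antitone_of_convex_of_bounded {F : ℕ → ℝ} {B : ℝ}
    (hconv : ∀ n, 0 ≤ F n - 2 * F (n + 1) + F (n + 2)) (hB : ∀ n, |F n| ≤ B) :
    Antitone F := by
  refine antitone_nat_of_succ_le fun n => ?_
  by_contra! hlt
  have hd : ∀ k, F (n + 1) - F n ≤ F (n + k + 1) - F (n + k) := by
    intro k
    induction k with
    | zero => simp
    | succ k ih =>
      have := hconv (n + k)
      rw [show n + (k + 1) + 1 = n + k + 2 by ring, show n + (k + 1) = n + k + 1 by ring]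
      linarith
  have hk : ∀ k : ℕ, F n + k * (F (n + 1) - F n) ≤ F (n + k) := by
    intro k
    induction k with
    | zero => simp
    | succ k ih =>
      have := hd k
      rw [show n + (k + 1) = n + k + 1 by ring]
      push_cast
      linarith
  obtain ⟨k, hk'⟩ := exists_nat_gt (2 * B / (F (n + 1) - F n))
  rw [div_lt_iff₀ (by linarith)] at hk'
  have h1 := hk k
  have h2 := abs_le.1 (hB n)
  have h3 := abs_le.1 (hB (n + k))
  linarith

open Polynomial in
/-- A linear functional on polynomials is a bounded semigroup-positive functional if it is
nonnegative on `Xⁿ q²` and bounded along `Xⁿ q`. -/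
structure IsBoundedPositive (L : ℝ[X] →ₗ[ℝ] ℝ) : Prop where
  nonneg : ∀ (n : ℕ) (q : ℝ[X]), 0 ≤ L (X ^ n * q ^ 2)
  bounded : ∀ q : ℝ[X], ∃ B : ℝ, ∀ n : ℕ, |L (X ^ n * q)| ≤ B

namespace IsBoundedPositive
open Polynomial

/-- The second differences of `n ↦ L (X ^ n * q ^ 2)` are the values of `L` at `X ^ n * ((1 - X) *
q) ^ 2`, so this bounded sequence is convex, hence decreasing. Iterating gives the complete
monotonicity that Hausdorff's theorem requires. -/
theorem comp_one_sub {L : ℝ[X] →ₗ[ℝ] ℝ} (h : IsBoundedPositive L) :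
    IsBoundedPositive (L ∘ₗ LinearMap.mulLeft ℝ (1 - X)) := by
  constructor
  · intro n q
    obtain ⟨B, hB⟩ := h.bounded (q ^ 2)
    have hanti : Antitone fun n => L (X ^ n * q ^ 2) := by
      refine antitone_of_convex_of_bounded (fun n => ?_) hB
      have := h.nonneg n ((1 - X) * q)
      have e : X ^ n * ((1 - X) * q) ^ 2 =
          X ^ n * q ^ 2 - (2 : ℝ) • (X ^ (n + 1) * q ^ 2) + X ^ (n + 2) * q ^ 2 := by
        rw [smul_eq_C_mul, map_ofNat]; ring
      rw [e] at this
      simpa using this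
    have := hanti (Nat.le_succ n)
    have e : (1 - X) * (X ^ n * q ^ 2) = X ^ n * q ^ 2 - X ^ (n + 1) * q ^ 2 := by ring
    simp only [LinearMap.comp_apply, LinearMap.mulLeft_apply, e, map_sub]
    linarith
  · intro q
    obtain ⟨B, hB⟩ := h.bounded ((1 - X) * q)
    refine ⟨B, fun n => ?_⟩
    convert hB n using 2
    simp only [LinearMap.comp_apply, LinearMap.mulLeft_apply]
    congr 1
    ring

theorem nonneg_mul_one_sub_pow {L : ℝ[X] →ₗ[ℝ] ℝ} (h : IsBoundedPositive L) (n l : ℕ) :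
    0 ≤ L (X ^ n * (1 - X) ^ l) := by
  induction l generalizing L with
  | zero => simpa using h.nonneg n 1
  | succ l ih =>
    have := ih h.comp_one_sub
    simp only [LinearMap.comp_apply, LinearMap.mulLeft_apply] at this
    convert this using 2
    ring

theorem bernstein_nonneg {L : ℝ[X] →ₗ[ℝ] ℝ} (h : IsBoundedPositive L) (n k : ℕ) :
    0 ≤ L (bernsteinPolynomial ℝ n k) := by
  have := mul_nonneg (Nat.cast_nonneg (α := ℝ) (n.choose k)) (h.nonneg_mul_one_sub_pow k (n - k))
  have e : bernsteinPolynomial ℝ n k = (n.choose k : ℝ) • (X ^ k * (1 - X) ^ (n - k)) := by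
    rw [bernsteinPolynomial, smul_eq_C_mul, map_natCast, mul_assoc]
  rw [e, map_smul]
  simpa using this

end IsBoundedPositive

open Polynomial in
-- Expand `X ^ j * (X + (1 - X)) ^ (n - j)` binomially; the terms with `k < j` have a vanishing
-- falling factorial.
theorem sum_descFactorial_smul_bernsteinPolynomial {j n : ℕ} (hj : j ≤ n) :
    ∑ k ∈ Finset.range (n + 1),
      ((k.descFactorial j : ℝ) / n.descFactorial j) • bernsteinPolynomial ℝ n k = X ^ j := by
  obtain ⟨m, rfl⟩ := Nat.exists_eq_add_of_le hj
  rw [show j + m + 1 = j + (m + 1) by ring, Finset.sum_range_add]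
  rw [Finset.sum_eq_zero, zero_add]
  · have h1 : (X : ℝ[X]) ^ j = X ^ j * (X + (1 - X)) ^ m := by simp
    rw [h1, add_pow, Finset.mul_sum]
    refine Finset.sum_congr rfl fun i hi => ?_
    have hi' : i ≤ m := by simpa [Nat.lt_succ_iff] using hi
    have hd : ((j + m).descFactorial j : ℝ) ≠ 0 := by
      exact_mod_cast Nat.descFactorial_eq_zero_iff_lt.not.2 (by omega)
    have hc : (((j + i).descFactorial j : ℝ) / (j + m).descFactorial j) * (j + m).choose (j + i)
        = m.choose i := by
      rw [div_mul_eq_mul_div, div_eq_iff hd]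
      rw [Nat.descFactorial_eq_factorial_mul_choose, Nat.descFactorial_eq_factorial_mul_choose]
      have := Nat.choose_mul (n := j + m) (k := j + i) (s := j)
      rw [Nat.add_sub_cancel_left, Nat.add_sub_cancel_left] at this
      have h' : (((j + m).choose (j + i) : ℕ) : ℝ) * ((j + i).choose j) =
        ((j + m).choose j) * (m.choose i) := by exact_mod_cast this (by omega)
      push_cast
      linear_combination (j.factorial : ℝ) * h'
    rw [bernsteinPolynomial, smul_eq_C_mul, show j + m - (j + i) = m - i by omega,
      ← C_eq_natCast (m.choose i), ← hc, map_mul, C_eq_natCast]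
    ring
  · intro k hk
    rw [Nat.descFactorial_eq_zero_iff_lt.2 (by simpa using hk)]
    simp

/-- Compares the value of `X ^ j` at the node `k / n` with its exact Bernstein coefficient. Both are
products of `j` factors in `[0,1]`, and exchanging the factor of index `i` costs at most `i / n`. -/
theorem abs_pow_sub_descFactorial_div_le {j n k : ℕ} (hj : j ≤ n) (hn : 0 < n) (hk : k ≤ n) :
    |((k : ℝ) / n) ^ j - (k.descFactorial j : ℝ) / n.descFactorial j| ≤ (j : ℝ) ^ 2 / n := by
  induction j with
  | zero => simp
  | succ j ih =>
    have ih := ih (by omega)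
    have hn' : (0 : ℝ) < n := by exact_mod_cast hn
    have hnj : (0 : ℝ) < (n : ℝ) - j := by
      have : (j : ℝ) < n := by exact_mod_cast hj
      linarith
    have hd : (0 : ℝ) < n.descFactorial j := by
      exact_mod_cast Nat.pos_of_ne_zero (Nat.descFactorial_eq_zero_iff_lt.not.2 (by omega))
    have hr0 : 0 ≤ (k.descFactorial j : ℝ) / n.descFactorial j := by positivity
    have hr1 : (k.descFactorial j : ℝ) / n.descFactorial j ≤ 1 := by
      rw [div_le_one hd]
      exact_mod_cast Nat.descFactorial_le j hk
    have hq0 : 0 ≤ (k : ℝ) / n := by positivity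
    have hkn : (k : ℝ) ≤ n := by exact_mod_cast hk
    have hq1 : (k : ℝ) / n ≤ 1 := by rw [div_le_one hn']; exact hkn
    have hs : |(k : ℝ) / n - ((k - j : ℕ) : ℝ) / ((n - j : ℕ) : ℝ)| ≤ j / n := by
      rw [Nat.cast_sub (show j ≤ n by omega)]
      -- For `k ≤ j` the truncated difference `k - j` is zero, and the claim is just `k / n ≤ j /
      -- n`.
      by_cases hkj : k ≤ j
      · rw [Nat.sub_eq_zero_of_le hkj]
        simp only [Nat.cast_zero, zero_div, sub_zero, abs_of_nonneg hq0]
        gcongr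
      · rw [Nat.cast_sub (by omega)]
        have e : (k : ℝ) / n - ((k : ℝ) - j) / ((n : ℝ) - j) =
            (j / n) * ((n - k) / (n - j)) := by
          field_simp; ring
        have hkj' : (j : ℝ) ≤ k := by exact_mod_cast (by omega : j ≤ k)
        have h01 : 0 ≤ ((n : ℝ) - k) / (n - j) := div_nonneg (by linarith) hnj.le
        have h02 : ((n : ℝ) - k) / (n - j) ≤ 1 := by rw [div_le_one hnj]; linarith
        rw [e, abs_of_nonneg (by positivity)]
        exact mul_le_of_le_one_right (by positivity) h02
    rw [Nat.descFactorial_succ, Nat.descFactorial_succ, Nat.cast_mul, Nat.cast_mul, mul_div_mul_comm,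
      pow_succ]
    set r := (k.descFactorial j : ℝ) / n.descFactorial j
    set q := (k : ℝ) / n
    set s := ((k - j : ℕ) : ℝ) / ((n - j : ℕ) : ℝ)
    have e : q ^ j * q - s * r = (q ^ j - r) * q + r * (q - s) := by ring
    calc |q ^ j * q - s * r| ≤ |(q ^ j - r) * q| + |r * (q - s)| := by rw [e]; exact abs_add_le _ _
      _ ≤ (j : ℝ) ^ 2 / n + j / n := by
        rw [abs_mul, abs_mul, abs_of_nonneg hq0, abs_of_nonneg hr0]
        refine add_le_add ?_ ?_
        · exact (mul_le_of_le_one_right (abs_nonneg _) hq1).trans ih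
        · exact (mul_le_of_le_one_left (abs_nonneg _) hr1).trans hs
      _ ≤ ((j + 1 : ℕ) : ℝ) ^ 2 / n := by
        rw [← add_div]
        gcongr
        push_cast
        nlinarith [Nat.cast_nonneg (α := ℝ) j]

open Polynomial Filter Topology unitInterval in
/-- **Hausdorff moment problem**: a normalised bounded positive functional is given by the moments
of a probability measure on the unit interval. -/
theorem IsBoundedPositive.exists_probabilityMeasure {L : ℝ[X] →ₗ[ℝ] ℝ} (h : IsBoundedPositive L)
    (h1 : L 1 = 1) :
    ∃ μ : ProbabilityMeasure I, ∀ j : ℕ, L (X ^ j) = ∫ t : I, (t : ℝ) ^ j ∂(μ : Measure I) := by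
  set p : ℕ → ℕ → I := fun n k => Set.projIcc (0 : ℝ) 1 zero_le_one ((k : ℝ) / n) with hp
  set b : ℕ → ℕ → ℝ := fun n k => L (bernsteinPolynomial ℝ n k) with hb
  have hb0 : ∀ n k, 0 ≤ b n k := fun n k => h.bernstein_nonneg n k
  have hb1 : ∀ n, ∑ k ∈ Finset.range (n + 1), b n k = 1 := fun n => by
    rw [hb, ← h1, ← bernsteinPolynomial.sum ℝ n, map_sum]
  -- The Bernstein measures: mass `L (bernsteinPolynomial ℝ n k)` at the node `k / n`. Their `j`-th
  -- moments differ from `L (X ^ j)` by at most `j² / n`.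
  set μ' : ℕ → Measure I := fun n =>
    ∑ k ∈ Finset.range (n + 1), ENNReal.ofReal (b n k) • Measure.dirac (p n k) with hμ'
  have hprob : ∀ n, IsProbabilityMeasure (μ' n) := fun n => ⟨by
    simp only [hμ', Measure.coe_finsetSum, Finset.sum_apply, Measure.smul_apply, measure_univ,
      smul_eq_mul, mul_one]
    rw [← ENNReal.ofReal_sum_of_nonneg fun k _ => hb0 n k, hb1, ENNReal.ofReal_one]⟩
  set μ : ℕ → ProbabilityMeasure I := fun n => ⟨μ' n, hprob n⟩ with hμ
  have hint : ∀ n (g : C(I, ℝ)), ∫ t, g t ∂(μ' n) = ∑ k ∈ Finset.range (n + 1), b n k * g (p n k) := by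
    intro n g
    rw [hμ', integral_finsetSum_measure]
    · refine Finset.sum_congr rfl fun k _ => ?_
      rw [integral_smul_measure, integral_dirac, ENNReal.toReal_ofReal (hb0 n k), smul_eq_mul]
    · intro k _
      exact (g.continuous.integrable_of_hasCompactSupport
        (HasCompactSupport.of_compactSpace g)).smul_measure ENNReal.ofReal_ne_top
  have hlim : ∀ j : ℕ, Tendsto (fun n => ∫ t : I, (t : ℝ) ^ j ∂(μ' n)) atTop (𝓝 (L (X ^ j))) := by
    intro j
    rw [tendsto_iff_norm_sub_tendsto_zero]
    refine squeeze_zero' (Eventually.of_forall fun _ => norm_nonneg _) ?_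
      (tendsto_const_div_atTop_nhds_zero_nat ((j : ℝ) ^ 2))
    filter_upwards [eventually_ge_atTop j, eventually_gt_atTop 0] with n hjn hn
    have hi := hint n ⟨fun t : I => (t : ℝ) ^ j, by fun_prop⟩
    simp only [ContinuousMap.coe_mk] at hi
    rw [hi, ← sum_descFactorial_smul_bernsteinPolynomial hjn, map_sum, ← Finset.sum_sub_distrib]
    refine (norm_sum_le _ _).trans ?_
    calc _ ≤ ∑ k ∈ Finset.range (n + 1), b n k * ((j : ℝ) ^ 2 / n) := by
          refine Finset.sum_le_sum fun k hk => ?_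
          have hk' : k ≤ n := by simpa [Nat.lt_succ_iff] using hk
          have hpk : ((p n k : I) : ℝ) = k / n := by
            have hmem : (k : ℝ) / n ∈ Set.Icc (0 : ℝ) 1 :=
              ⟨by positivity, div_le_one_of_le₀ (by exact_mod_cast hk') (by positivity)⟩
            simp only [hp, Set.projIcc_of_mem zero_le_one hmem]
          simp only [hpk, map_smul, smul_eq_mul]
          rw [mul_comm _ (L _), ← mul_sub, norm_mul, Real.norm_of_nonneg (hb0 n k)]
          exact mul_le_mul_of_nonneg_left (abs_pow_sub_descFactorial_div_le hjn hn hk') (hb0 n k)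
      _ = (j : ℝ) ^ 2 / n := by rw [← Finset.sum_mul, hb1, one_mul]
  -- Probability measures on a compact space form a compact space; an ultrafilter limit replaces the
  -- choice of a weakly convergent subsequence.
  obtain ⟨ν, -, hν⟩ := isCompact_univ.ultrafilter_le_nhds ((hyperfilter ℕ : Ultrafilter ℕ).map μ)
    (by simp)
  refine ⟨ν, fun j => ?_⟩
  have hν' : Tendsto μ (hyperfilter ℕ : Filter ℕ) (𝓝 ν) := hν
  have h2 := (ProbabilityMeasure.tendsto_iff_forall_integral_tendsto.1 hν')
    (BoundedContinuousFunction.mkOfCompact ⟨fun t : I => (t : ℝ) ^ j, by fun_prop⟩)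
  exact tendsto_nhds_unique ((hlim j).mono_left Nat.hyperfilter_le_atTop) h2

open Polynomial in
/-- The linear functional on polynomials with prescribed moments. -/
noncomputable def momentFunctional (c : ℕ → ℝ) : ℝ[X] →ₗ[ℝ] ℝ :=
  (Polynomial.basisMonomials ℝ).constr ℝ c

open Polynomial in
theorem momentFunctional_X_pow (c : ℕ → ℝ) (n : ℕ) : momentFunctional c (X ^ n) = c n := by
  have := (Polynomial.basisMonomials ℝ).constr_basis ℝ c n
  rw [Polynomial.coe_basisMonomials] at this
  rw [X_pow_eq_monomial]
  exact this

open Polynomial in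
theorem isBoundedPositive_momentFunctional {c : ℕ → ℝ} {B : ℝ} (hB : ∀ n, |c n| ≤ B)
    (hpos : ∀ (n : ℕ) (s : Finset ℕ) (b : ℕ → ℝ),
      0 ≤ ∑ i ∈ s, ∑ j ∈ s, b i * b j * c (n + i + j)) :
    IsBoundedPositive (momentFunctional c) := by
  constructor
  · intro n q
    convert hpos n q.support q.coeff using 1
    conv_lhs => rw [q.as_sum_support_C_mul_X_pow]
    rw [sq, Finset.sum_mul_sum, Finset.mul_sum, map_sum]
    refine Finset.sum_congr rfl fun i _ => ?_
    rw [Finset.mul_sum, map_sum]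
    refine Finset.sum_congr rfl fun j _ => ?_
    rw [show X ^ n * (C (q.coeff i) * X ^ i * (C (q.coeff j) * X ^ j)) =
      (q.coeff i * q.coeff j) • (X ^ (n + i + j) : ℝ[X]) by
        rw [smul_eq_C_mul, C.map_mul]; ring, map_smul, momentFunctional_X_pow, smul_eq_mul]
  · intro q
    refine ⟨∑ i ∈ q.support, |q.coeff i| * B, fun n => ?_⟩
    conv_lhs => rw [q.as_sum_support_C_mul_X_pow]
    rw [Finset.mul_sum, map_sum]
    refine (Finset.abs_sum_le_sum_abs _ _).trans (Finset.sum_le_sum fun i _ => ?_)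
    rw [show X ^ n * (C (q.coeff i) * X ^ i) = q.coeff i • (X ^ (n + i) : ℝ[X]) by
      rw [smul_eq_C_mul]; ring, map_smul, momentFunctional_X_pow, smul_eq_mul, abs_mul]
    exact mul_le_mul_of_nonneg_left (hB _) (abs_nonneg _)

/-! ### Positive definiteness of the kernel. -/

section Kernel

variable {Ω : Type*} [MeasurableSpace Ω] {P : Measure Ω} {N : ℕ} {m : ℝ} {C : ℝ≥0 → ℝ}
  {f : EuclideanSpace ℝ (Fin N) → Ω → ℝ}

theorem IsStationaryIsotropicGRF.memLp_two (hf : IsStationaryIsotropicGRF P N m C f)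
    (x : EuclideanSpace ℝ (Fin N)) : MemLp (f x) 2 P :=
  (hf.gaussian.hasGaussianLaw_eval x).memLp_two

theorem IsStationaryIsotropicGRF.sum_mul_sum_mul_nonneg [IsProbabilityMeasure P] (hN : 1 ≤ N)
    (hf : IsStationaryIsotropicGRF P N m C f) {ι : Type*} (s : Finset ι) (c : ι → ℝ)
    (x : ι → EuclideanSpace ℝ (Fin N)) :
    0 ≤ ∑ i ∈ s, ∑ j ∈ s, c i * c j * C (‖x i - x j‖₊ ^ 2 / 2) := by
  have hN' : (0 : ℝ) < N := by exact_mod_cast hN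
  have hm : ∀ i ∈ s, MemLp (fun ω => c i * f (x i) ω) 2 P := fun i _ =>
    (hf.memLp_two (x i)).const_mul (c i)
  have h1 := covariance_fun_sum_fun_sum' hm hm
  rw [covariance_self (memLp_finsetSum s hm).aemeasurable] at h1
  have h2 := variance_nonneg (fun ω => ∑ i ∈ s, c i * f (x i) ω) P
  rw [h1] at h2
  simp_rw [covariance_const_mul_left, covariance_const_mul_right, hf.cov] at h2
  have h3 : ∑ i ∈ s, ∑ j ∈ s, c i * (c j * (1 / (N : ℝ) * C (‖x i - x j‖₊ ^ 2 / 2))) =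
      (1 / (N : ℝ)) * ∑ i ∈ s, ∑ j ∈ s, c i * c j * C (‖x i - x j‖₊ ^ 2 / 2) := by
    simp_rw [Finset.mul_sum]
    exact Finset.sum_congr rfl fun i _ => Finset.sum_congr rfl fun j _ => by ring
  rw [h3] at h2
  exact nonneg_of_mul_nonneg_right h2 (by positivity)

end Kernel

/-! ### Schoenberg's theorem. -/

section Valid

variable {C : ℝ≥0 → ℝ}

theorem ValidInAllDimensions.sum_mul_sum_mul_nonneg (hC : ValidInAllDimensions C) {N : ℕ}
    (hN : 1 ≤ N) {ι : Type*} (s : Finset ι) (c : ι → ℝ) (x : ι → EuclideanSpace ℝ (Fin N)) :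
    0 ≤ ∑ i ∈ s, ∑ j ∈ s, c i * c j * C (‖x i - x j‖₊ ^ 2 / 2) := by
  obtain ⟨Ω, _, P, m, f, _, hf⟩ := hC N hN
  exact hf.sum_mul_sum_mul_nonneg hN s c x

/-- Positive definiteness at two points of the line, with weights `(1, 1)` and `(1, -1)`. -/
theorem ValidInAllDimensions.abs_le (hC : ValidInAllDimensions C) (s : ℝ≥0) : |C s| ≤ C 0 := by
  set a : EuclideanSpace ℝ (Fin 1) := EuclideanSpace.single 0 (Real.sqrt (2 * s)) with ha
  have hna : ‖a‖₊ ^ 2 / 2 = s := by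
    ext
    push_cast
    rw [ha, PiLp.norm_single, Real.norm_eq_abs, sq_abs, Real.sq_sqrt (by positivity)]
    ring
  have key : ∀ c : Fin 2 → ℝ, 0 ≤ (c 0 ^ 2 + c 1 ^ 2) * C 0 + 2 * (c 0 * c 1) * C s := by
    intro c
    have := hC.sum_mul_sum_mul_nonneg le_rfl Finset.univ c ![0, a]
    simp only [Fin.sum_univ_two, Matrix.cons_val_zero, Matrix.cons_val_one, sub_self, zero_sub,
      sub_zero, nnnorm_neg, hna, nnnorm_zero, ne_eq, OfNat.ofNat_ne_zero, not_false_eq_true,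
      zero_pow, zero_div] at this
    linarith
  have h1 := key ![1, 1]
  have h2 := key ![1, -1]
  simp at h1 h2
  rw [_root_.abs_le]
  constructor <;> linarith

/-- This is where all dimensions are used. Repeat one configuration on each of `M + 1` orthogonal
axes: pairs on different axes see the sum of the squared radii, and for large `M` these cross terms
dominate. This turns positivity in differences into positivity in sums of arguments. -/
theorem ValidInAllDimensions.sum_mul_sum_mul_add_nonneg (hC : ValidInAllDimensions C) (h : ℝ≥0)
    (n : ℕ) (s : Finset ℕ) (b : ℕ → ℝ) :
    0 ≤ ∑ i ∈ s, ∑ j ∈ s, b i * b j * C (h * (n + i + j : ℕ)) := by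
  set A := ∑ i ∈ s, ∑ j ∈ s, b i * b j * C (h * (n + i + j : ℕ)) with hA
  -- Chosen so that `(r i ^ 2 + r j ^ 2) / 2 = h * (n + i + j)`.
  set r : ℕ → ℝ := fun i => Real.sqrt (2 * h * i + h * n) with hr
  have hr2 : ∀ i, r i ^ 2 = 2 * h * i + h * n := fun i => Real.sq_sqrt (by positivity)
  set D := ∑ i ∈ s, ∑ j ∈ s, b i * b j * C (‖r i - r j‖₊ ^ 2 / 2) with hD
  -- The full quadratic form has `M + 1` diagonal blocks `D` and `(M + 1) * M` off-diagonal blocks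
  -- `A`; divide it by `M + 1`.
  have key : ∀ M : ℕ, 0 ≤ D + M * A := by
    intro M
    have h0 := hC.sum_mul_sum_mul_nonneg (Nat.succ_pos M)
      ((Finset.univ : Finset (Fin (M + 1))) ×ˢ s) (fun p => b p.2)
      (fun p => EuclideanSpace.single p.1 (r p.2))
    simp_rw [Finset.sum_product] at h0
    have h1 : ∀ p q : Fin (M + 1), ∑ i ∈ s, ∑ j ∈ s, b i * b j *
        C (‖EuclideanSpace.single p (r i) - EuclideanSpace.single q (r j)‖₊ ^ 2 / 2) =
        A + if p = q then D - A else 0 := by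
      intro p q
      split_ifs with hpq
      · rw [add_sub_cancel, hD]
        refine Finset.sum_congr rfl fun i _ => Finset.sum_congr rfl fun j _ => ?_
        rw [hpq]
        congr 4
        ext
        rw [coe_nnnorm, coe_nnnorm, ← PiLp.single_sub, PiLp.norm_single]
      · rw [add_zero, hA]
        refine Finset.sum_congr rfl fun i _ => Finset.sum_congr rfl fun j _ => ?_
        congr 2
        ext
        push_cast
        rw [@norm_sub_sq_real, EuclideanSpace.inner_single_left, PiLp.norm_single,
          PiLp.norm_single, Real.norm_eq_abs, Real.norm_eq_abs, sq_abs, sq_abs, hr2, hr2]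
        simp [hpq]
        ring
    have h2 : ∀ p : Fin (M + 1), ∑ i ∈ s, ∑ q : Fin (M + 1), ∑ j ∈ s, b i * b j *
        C (‖EuclideanSpace.single p (r i) - EuclideanSpace.single q (r j)‖₊ ^ 2 / 2) =
        (M + 1) * A + (D - A) := by
      intro p
      rw [Finset.sum_comm]
      simp_rw [h1]
      simp [Finset.sum_add_distrib]
    simp_rw [h2] at h0
    simp only [Finset.sum_const, Finset.card_univ, Fintype.card_fin, nsmul_eq_mul] at h0
    have := nonneg_of_mul_nonneg_right h0 (by positivity)
    linarith
  by_contra! hlt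
  obtain ⟨M, hM⟩ := exists_nat_gt (D / -A)
  rw [div_lt_iff₀ (by linarith)] at hM
  linarith [key M]

open Filter Topology unitInterval in
/-- **Schoenberg's theorem**: a continuous kernel that is valid in all dimensions is a mixture of
exponentials. -/
theorem ValidInAllDimensions.exists_probabilityMeasure (hC : ValidInAllDimensions C)
    (hcont : Continuous C) (h0 : 0 < C 0) :
    ∃ ν : ProbabilityMeasure I, (ν : Measure I) {0} = 0 ∧
      ∀ s : ℝ≥0, C s = C 0 * ∫ t : I, (t : ℝ) ^ (s : ℝ) ∂(ν : Measure I) := by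
  have hcmap : ∀ s : ℝ≥0, Continuous fun t : I => (t : ℝ) ^ (s : ℝ) := fun s =>
    continuous_subtype_val.rpow_const fun _ => Or.inr s.2
  have hk : ∀ k : ℕ, ∃ ν : ProbabilityMeasure I, ∀ n : ℕ,
      C (n / 2 ^ k) = C 0 * ∫ t : I, (t : ℝ) ^ ((n / 2 ^ k : ℝ≥0) : ℝ) ∂(ν : Measure I) := by
    intro k
    have hL : IsBoundedPositive (momentFunctional fun n => C (n / 2 ^ k) / C 0) := by
      refine isBoundedPositive_momentFunctional (B := 1) (fun n => ?_) fun n s b => ?_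
      · rw [abs_div, abs_of_pos h0]
        exact div_le_one_of_le₀ (hC.abs_le _) h0.le
      · have := div_nonneg (hC.sum_mul_sum_mul_add_nonneg (2 ^ k)⁻¹ n s b) h0.le
        simp_rw [Finset.sum_div, inv_mul_eq_div, mul_div_assoc] at this
        exact this
    obtain ⟨μ, hμ⟩ := hL.exists_probabilityMeasure (by
      rw [← pow_zero Polynomial.X, momentFunctional_X_pow]
      simp [h0.ne'])
    -- Pushing forward along this map turns the moment of order `n` into the one of order `n / 2 ^
    -- k`.
    have hg : Continuous fun t : I => t ^ 2 ^ k := by fun_prop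
    refine ⟨μ.map hg.aemeasurable, fun n => ?_⟩
    rw [ProbabilityMeasure.toMeasure_map, integral_map hg.aemeasurable
      (hcmap _).aestronglyMeasurable]
    have := hμ n
    rw [momentFunctional_X_pow, div_eq_iff h0.ne', mul_comm] at this
    rw [this]
    congr 2
    ext t
    push_cast
    rw [← Real.rpow_natCast _ (2 ^ k), ← Real.rpow_mul t.2.1, Nat.cast_pow, Nat.cast_ofNat,
      mul_div_cancel₀ _ (by positivity), Real.rpow_natCast]
  choose μ hμ using hk
  obtain ⟨ν, -, hν⟩ := isCompact_univ.ultrafilter_le_nhds ((hyperfilter ℕ : Ultrafilter ℕ).map μ)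
    (by simp)
  have hν' : Tendsto μ (hyperfilter ℕ : Filter ℕ) (𝓝 ν) := hν
  have hdy : ∀ n k : ℕ, C (n / 2 ^ k) =
      C 0 * ∫ t : I, (t : ℝ) ^ ((n / 2 ^ k : ℝ≥0) : ℝ) ∂(ν : Measure I) := by
    intro n k
    have h2 := ((ProbabilityMeasure.tendsto_iff_forall_integral_tendsto.1 hν')
      (BoundedContinuousFunction.mkOfCompact ⟨_, hcmap (n / 2 ^ k)⟩)).const_mul (C 0)
    refine tendsto_nhds_unique ?_ h2
    refine Tendsto.mono_left ?_ Nat.hyperfilter_le_atTop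
    refine tendsto_const_nhds.congr' ?_
    filter_upwards [eventually_ge_atTop k] with j hj
    -- A dyadic of level `k` has every level `j ≥ k`, so the integrals are eventually constant in
    -- `j`.
    have e : (n / 2 ^ k : ℝ≥0) = (n * 2 ^ (j - k) : ℕ) / 2 ^ j := by
      obtain ⟨i, rfl⟩ := Nat.exists_eq_add_of_le hj
      rw [Nat.add_sub_cancel_left, pow_add]
      push_cast
      rw [mul_div_mul_right _ _ (by positivity)]
    simp only [BoundedContinuousFunction.mkOfCompact_apply, ContinuousMap.coe_mk]
    rw [e]
    exact hμ j _
  have hlim : ∀ (u : ℕ → ℝ≥0) (s : ℝ≥0) (F : I → ℝ), Tendsto u atTop (𝓝 s) →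
      (∀ i, C (u i) = C 0 * ∫ t : I, (t : ℝ) ^ (u i : ℝ) ∂(ν : Measure I)) →
      (∀ t : I, Tendsto (fun i => (t : ℝ) ^ (u i : ℝ)) atTop (𝓝 (F t))) →
      C s = C 0 * ∫ t : I, F t ∂(ν : Measure I) := by
    intro u s F hu hCu hF
    refine tendsto_nhds_unique ((hcont.tendsto s).comp hu) ?_
    simp only [Function.comp_def, hCu]
    refine Tendsto.const_mul _ (tendsto_integral_of_dominated_convergence (fun _ => 1)
      (fun i => (hcmap _).aestronglyMeasurable) (integrable_const _) (fun i => ?_)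
      (Eventually.of_forall hF))
    refine Eventually.of_forall fun t => ?_
    rw [Real.norm_of_nonneg (Real.rpow_nonneg t.2.1 _)]
    exact Real.rpow_le_one t.2.1 t.2.2 (NNReal.coe_nonneg _)
  have hpow : Tendsto (fun k : ℕ => (2 : ℝ) ^ k) atTop atTop :=
    tendsto_pow_atTop_atTop_of_one_lt one_lt_two
  refine ⟨ν, ?_, fun s => ?_⟩
  -- As the exponent decreases to `0`, `t ^ s` tends to the indicator of `t ≠ 0`; continuity of `C`
  -- at `0` thus gives `ν {0}ᶜ = 1`.
  · have h1 := hlim (fun k => (1 : ℕ) / 2 ^ k) 0 (({0}ᶜ : Set I).indicator 1) (by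
      rw [← NNReal.tendsto_coe]
      push_cast
      exact tendsto_const_nhds.div_atTop hpow) (fun k => hdy 1 k) (fun t => by
        by_cases ht : t = 0
        · subst ht
          simp only [Set.mem_compl_iff, Set.mem_singleton_iff, not_true, not_false_eq_true,
            Set.indicator_of_notMem, Set.Icc.coe_zero]
          refine tendsto_const_nhds.congr fun k => ?_
          rw [Real.zero_rpow]
          push_cast
          positivity
        · rw [Set.indicator_of_mem (Set.mem_compl_singleton_iff.2 ht), Pi.one_apply,
            ← Real.rpow_zero (t : ℝ)]
          refine ((Real.continuousAt_const_rpow (fun h => ht (Subtype.ext h))).tendsto).comp ?_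
          push_cast
          exact tendsto_const_nhds.div_atTop hpow)
    rw [integral_indicator_one (measurableSet_singleton _).compl, left_eq_mul₀ h0.ne',
      probReal_compl_eq_one_sub (measurableSet_singleton _)] at h1
    have h2 : (ν : Measure I).real {0} = 0 := by linarith
    rwa [measureReal_eq_zero_iff] at h2
  -- The exponent `0` is separate because `s ↦ 0 ^ s` jumps there.
  · rcases eq_or_ne s 0 with rfl | hs
    · simp
    · have hs' : (s : ℝ) ≠ 0 := by exact_mod_cast hs
      have hu : Tendsto (fun k : ℕ => ((⌊(s : ℝ) * 2 ^ k⌋₊ / 2 ^ k : ℝ≥0) : ℝ)) atTop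
          (𝓝 (s : ℝ)) := by
        push_cast
        exact (tendsto_nat_floor_mul_div_atTop s.2).comp hpow
      refine hlim (fun k => ⌊(s : ℝ) * 2 ^ k⌋₊ / 2 ^ k) s _ ?_ (fun k => hdy _ k) fun t => ?_
      · exact NNReal.tendsto_coe.1 hu
      · exact (Real.continuousAt_const_rpow' hs').tendsto.comp hu

end Valid

/-! ### The spectral measure and its full support. -/

section Spectral

instance isOpenPosMeasure_gaussianReal {μ : ℝ} {v : ℝ≥0} [NeZero v] :
    (gaussianReal μ v).IsOpenPosMeasure :=
  (gaussianReal_absolutelyContinuous' μ (NeZero.ne v)).isOpenPosMeasure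

variable {N : ℕ} {C : ℝ≥0 → ℝ}

instance isOpenPosMeasure_stdGaussian :
    (stdGaussian (EuclideanSpace ℝ (Fin N))).IsOpenPosMeasure := by
  rw [← map_pi_eq_stdGaussian]
  exact (PiLp.continuous_toLp 2 _).isOpenPosMeasure_map (WithLp.toLp_surjective 2)

open unitInterval in
/-- The spectral measure of a continuous nonconstant kernel that is valid in all dimensions: a
finite measure of full support whose characteristic function is the kernel. -/
theorem ValidInAllDimensions.exists_spectralMeasure (hC : ValidInAllDimensions C)
    (hcont : Continuous C) (hconst : ∃ s, C s ≠ C 0) (hN : 1 ≤ N) :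
    ∃ ρ : Measure (EuclideanSpace ℝ (Fin N)), IsFiniteMeasure ρ ∧ ρ.IsOpenPosMeasure ∧
      ∀ x, charFun ρ x = ((1 / (N : ℝ) * C (‖x‖₊ ^ 2 / 2) : ℝ) : ℂ) := by
  have h0 : 0 < C 0 := by
    by_contra! hle
    obtain ⟨s, hs⟩ := hconst
    have h1 := hC.abs_le s
    have h2 := abs_nonneg (C s)
    have h3 : C 0 = 0 := by linarith
    rw [h3] at h1 hs
    exact hs (abs_nonpos_iff.1 h1)
  have hN' : (0 : ℝ) < N := by exact_mod_cast hN
  obtain ⟨ν, hν0, hν⟩ := hC.exists_probabilityMeasure hcont h0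
  have hne0 : ∀ᵐ t : I ∂(ν : Measure I), t ≠ 0 := by
    rw [ae_iff]
    simpa using hν0
  set E := EuclideanSpace ℝ (Fin N) with hE
  -- A Gaussian scale mixture: given `t > 0`, the characteristic function at `x` is `exp(log t *
  -- ‖x‖² / 2) = t ^ (‖x‖² / 2)`. The default value `log 0 = 0` is harmless since `ν {0} = 0`.
  set W : I × E → E := fun p => Real.sqrt (-Real.log p.1) • p.2 with hW
  have hWm : Measurable W := by fun_prop
  set τ : Measure E := ((ν : Measure I).prod (stdGaussian E)).map W with hτ
  have hτp : IsProbabilityMeasure τ := Measure.isProbabilityMeasure_map hWm.aemeasurable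
  have hτo : τ.IsOpenPosMeasure := by
    refine ⟨fun U hU hUne hzero => ?_⟩
    rw [hτ, Measure.map_apply hWm hU.measurableSet,
      Measure.prod_apply (hWm hU.measurableSet),
      lintegral_eq_zero_iff (measurable_measure_prodMk_left (hWm hU.measurableSet))] at hzero
    -- For `0 < t < 1` the slice of `U` is open and nonempty, so it has positive Gaussian measure. A
    -- null `U` would put all mass of `ν` at `1` and make `C` constant.
    have h1 : ∀ᵐ t : I ∂(ν : Measure I), t = 1 := by
      filter_upwards [hzero, hne0] with t ht ht0
      by_contra ht1
      have hpos : 0 < Real.sqrt (-Real.log t) := by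
        refine Real.sqrt_pos.2 (neg_pos.2 (Real.log_neg ?_ ?_))
        · exact lt_of_le_of_ne t.2.1 fun h => ht0 (Subtype.ext h.symm)
        · exact lt_of_le_of_ne t.2.2 fun h => ht1 (Subtype.ext h)
      have hc : Continuous fun z : E => Real.sqrt (-Real.log t) • z := by fun_prop
      refine (hU.preimage hc).measure_ne_zero (stdGaussian E) ?_ ht
      obtain ⟨u, hu⟩ := hUne
      exact ⟨(Real.sqrt (-Real.log t))⁻¹ • u, by simpa [smul_smul, hpos.ne'] using hu⟩
    obtain ⟨s, hs⟩ := hconst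
    refine hs ?_
    rw [hν s, integral_congr_ae (g := fun _ => (1 : ℝ)) (by
      filter_upwards [h1] with t ht
      simp [ht])]
    simp
  refine ⟨ENNReal.ofReal (C 0 / N) • τ, Measure.smul_finite _ ENNReal.ofReal_ne_top, ?_,
    fun x => ?_⟩
  · refine (Measure.absolutelyContinuous_smul ?_).isOpenPosMeasure
    exact (ENNReal.ofReal_pos.2 (by positivity)).ne'
  · rw [charFun_apply, integral_smul_measure, ENNReal.toReal_ofReal (by positivity), hτ,
      integral_map hWm.aemeasurable (by fun_prop), integral_prod]
    · have h1 : ∀ t : I, t ≠ 0 → ∫ z : E, Complex.exp (inner ℝ (W (t, z)) x * Complex.I)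
          ∂(stdGaussian E) = (((t : ℝ) ^ ((‖x‖₊ ^ 2 / 2 : ℝ≥0) : ℝ) : ℝ) : ℂ) := by
        intro t ht
        have htpos : (0 : ℝ) < t := lt_of_le_of_ne t.2.1 fun h => ht (Subtype.ext h.symm)
        have h2 := charFun_stdGaussian (E := E) (Real.sqrt (-Real.log t) • x)
        rw [charFun_apply] at h2
        simp only [hW, real_inner_smul_left, real_inner_smul_right] at h2 ⊢
        rw [h2, norm_smul, ← Complex.ofReal_pow, mul_pow, Real.norm_eq_abs, sq_abs,
          Real.rpow_def_of_pos htpos, Real.sq_sqrt (neg_nonneg.2 (Real.log_nonpos t.2.1 t.2.2))]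
        push_cast
        congr 1
        ring
      rw [integral_congr_ae (by
        filter_upwards [hne0] with t ht
        exact h1 t ht), integral_complex_ofReal, hν (‖x‖₊ ^ 2 / 2)]
      rw [Complex.real_smul, ← Complex.ofReal_mul]
      congr 1
      ring
    · refine Integrable.of_bound (by fun_prop) 1 (Filter.Eventually.of_forall fun p => ?_)
      rw [Complex.norm_exp_ofReal_mul_I]

end Spectral

/-! ### Centred Gaussian variables under `L²` and almost sure limits. -/

section CenteredGaussian

open Filter Topology

variable {Ω : Type*} [MeasurableSpace Ω] {P : Measure Ω} [IsProbabilityMeasure P]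

theorem MeasureTheory.Lp.integrable_of_two (Y : Lp ℝ 2 P) : Integrable Y P :=
  (Lp.memLp Y).integrable one_le_two

theorem MeasureTheory.Lp.sq_norm_eq_integral {α F : Type*} [MeasurableSpace α] {μ : Measure α}
    [NormedAddCommGroup F] (Y : Lp F 2 μ) : ‖Y‖ ^ 2 = ∫ a, ‖Y a‖ ^ 2 ∂μ := by
  have h := (Lp.memLp Y).eLpNorm_eq_integral_rpow_norm two_ne_zero ENNReal.ofNat_ne_top
  have h0 : 0 ≤ ∫ a, ‖Y a‖ ^ 2 ∂μ := integral_nonneg fun _ => by positivity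
  simp only [ENNReal.toReal_ofNat, Real.rpow_ofNat] at h
  rw [Lp.norm_def, h, ENNReal.toReal_ofReal (by positivity), ← Real.rpow_natCast,
    ← Real.rpow_mul h0]
  norm_num

theorem MeasureTheory.Lp.integral_abs_le_norm (Y : Lp ℝ 2 P) : ∫ ω, |Y ω| ∂P ≤ ‖Y‖ := by
  have h := eLpNorm_le_eLpNorm_of_exponent_le (μ := P) (f := Y) one_le_two
    (Lp.aestronglyMeasurable Y)
  rw [Lp.norm_def]
  have h2 := ENNReal.toReal_mono (Lp.eLpNorm_ne_top Y) h
  rwa [eLpNorm_one_eq_lintegral_enorm, ← integral_norm_eq_lintegral_enorm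
    (Lp.aestronglyMeasurable Y)] at h2

theorem MeasureTheory.Lp.continuous_integral_of_lipschitz {g : ℝ → ℝ} (hg : LipschitzWith 1 g) :
    Continuous fun Y : Lp ℝ 2 P => ∫ ω, g (Y ω) ∂P := by
  have hint : ∀ Y : Lp ℝ 2 P, Integrable (fun ω => g (Y ω)) P := fun Y => by
    have h1 : Integrable (fun ω => g (Y ω) - g 0) P := by
      refine (Lp.integrable_of_two Y).mono ?_ (Eventually.of_forall fun ω => ?_)
      · exact (hg.continuous.comp_aestronglyMeasurable (Lp.aestronglyMeasurable Y)).sub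
          aestronglyMeasurable_const
      · simpa [Real.dist_eq] using hg.dist_le_mul (Y ω) 0
    exact (h1.add (integrable_const (g 0))).congr (Eventually.of_forall fun ω => by simp)
  have : LipschitzWith 1 fun Y : Lp ℝ 2 P => ∫ ω, g (Y ω) ∂P := by
    refine LipschitzWith.of_dist_le_mul fun Y Z => ?_
    rw [Real.dist_eq, _root_.dist_eq_norm, ← integral_sub (hint Y) (hint Z), NNReal.coe_one, one_mul]
    refine abs_integral_le_integral_abs.trans
      (le_trans ?_ (Lp.integral_abs_le_norm (Y - Z)))
    refine integral_mono_ae ((hint Y).sub (hint Z)).abs (Lp.integrable_of_two _).abs ?_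
    filter_upwards [Lp.coeFn_sub Y Z] with ω hω
    rw [hω]
    simpa [Real.dist_eq] using hg.dist_le_mul (Y ω) (Z ω)
  exact this.continuous

/-- The two consequences of being a centred Gaussian random variable that survive `L²` limits. -/
structure IsCenteredGaussian (Y : Lp ℝ 2 P) : Prop where
  integral_eq_zero : ∫ ω, Y ω ∂P = 0
  integral_cos : ∫ ω, Real.cos (Y ω) ∂P = Real.exp (-‖Y‖ ^ 2 / 2)

/-- The identity and the cosine are 1-Lipschitz, so both expectations are continuous on `L²`. -/
theorem isClosed_setOf_isCenteredGaussian : IsClosed {Y : Lp ℝ 2 P | IsCenteredGaussian Y} := by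
  have e : {Y : Lp ℝ 2 P | IsCenteredGaussian Y} = {Y : Lp ℝ 2 P | ∫ ω, Y ω ∂P = 0} ∩
      {Y : Lp ℝ 2 P | ∫ ω, Real.cos (Y ω) ∂P = Real.exp (-‖Y‖ ^ 2 / 2)} :=
    Set.ext fun Y => ⟨fun h => ⟨h.1, h.2⟩, fun h => ⟨h.1, h.2⟩⟩
  rw [e]
  refine (isClosed_eq (Lp.continuous_integral_of_lipschitz (g := id) LipschitzWith.id)
    continuous_const).inter (isClosed_eq (Lp.continuous_integral_of_lipschitz ?_) (by fun_prop))
  exact Real.lipschitzWith_cos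

/-- By dominated convergence `E cos(Yₙ - Yₘ)` tends to `1`; it equals `exp(-‖Yₙ - Yₘ‖² / 2)`, so the
norms tend to `0`. -/
theorem cauchySeq_of_isCenteredGaussian_sub {Y : ℕ → Lp ℝ 2 P} {y : Ω → ℝ}
    (hY : ∀ n m, IsCenteredGaussian (Y n - Y m))
    (hy : ∀ᵐ ω ∂P, Tendsto (fun n => Y n ω) atTop (𝓝 (y ω))) : CauchySeq Y := by
  have h1 : Tendsto (fun p : ℕ × ℕ => ∫ ω, Real.cos ((Y p.1 - Y p.2 : Lp ℝ 2 P) ω) ∂P) atTop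
      (𝓝 (∫ _, 1 ∂P)) := by
    refine tendsto_integral_filter_of_dominated_convergence (fun _ => 1)
      (Eventually.of_forall fun p => ?_) (Eventually.of_forall fun p => ?_) (integrable_const _) ?_
    · exact Real.continuous_cos.comp_aestronglyMeasurable (Lp.aestronglyMeasurable _)
    · exact Eventually.of_forall fun ω => Real.abs_cos_le_one _
    · have h2 : ∀ᵐ ω ∂P, ∀ p : ℕ × ℕ, (Y p.1 - Y p.2 : Lp ℝ 2 P) ω = Y p.1 ω - Y p.2 ω :=
        ae_all_iff.2 fun p => Lp.coeFn_sub _ _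
      filter_upwards [hy, h2] with ω hω h2ω
      simp only [h2ω]
      rw [← Real.cos_zero, ← sub_self (y ω), ← prod_atTop_atTop_eq]
      exact (Real.continuous_cos.tendsto _).comp
        ((hω.comp tendsto_fst).sub (hω.comp tendsto_snd))
  simp only [(hY _ _).integral_cos, integral_const, probReal_univ, smul_eq_mul, mul_one] at h1
  have h2 := (Real.continuousAt_log one_ne_zero).tendsto.comp h1
  simp only [Function.comp_def, Real.log_exp, Real.log_one] at h2
  have h3 : Tendsto (fun p : ℕ × ℕ => Real.sqrt (-2 * (-‖Y p.1 - Y p.2‖ ^ 2 / 2))) atTop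
      (𝓝 (Real.sqrt (-2 * 0))) := (Real.continuous_sqrt.tendsto _).comp (h2.const_mul _)
  rw [mul_zero, Real.sqrt_zero] at h3
  rw [cauchySeq_iff_tendsto_dist_atTop_0]
  refine h3.congr fun p => ?_
  rw [show -2 * (-‖Y p.1 - Y p.2‖ ^ 2 / 2) = ‖Y p.1 - Y p.2‖ ^ 2 by ring,
    Real.sqrt_sq (norm_nonneg _), dist_eq_norm]

theorem MeasureTheory.Lp.ae_eq_of_tendsto_of_ae_tendsto {α F : Type*} [MeasurableSpace α]
    {μ : Measure α} [IsFiniteMeasure μ] [NormedAddCommGroup F] {Y : ℕ → Lp F 2 μ} {Z : Lp F 2 μ}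
    {y : α → F} (hY : Tendsto Y atTop (𝓝 Z))
    (hy : ∀ᵐ ω ∂μ, Tendsto (fun n => Y n ω) atTop (𝓝 (y ω))) : Z =ᵐ[μ] y :=
  tendstoInMeasure_ae_unique (tendstoInMeasure_of_tendsto_Lp hY)
    (tendstoInMeasure_of_tendsto_ae (fun _ => Lp.aestronglyMeasurable _) hy)

end CenteredGaussian

/-! ### The random function as a curve in `L²`. -/

section Feature

variable {Ω : Type*} [MeasurableSpace Ω] {P : Measure Ω} [IsProbabilityMeasure P] {N : ℕ} {m : ℝ}
  {C : ℝ≥0 → ℝ} {f : EuclideanSpace ℝ (Fin N) → Ω → ℝ}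

theorem IsStationaryIsotropicGRF.memLp_sub_mean (hf : IsStationaryIsotropicGRF P N m C f)
    (x : EuclideanSpace ℝ (Fin N)) : MemLp (fun ω => f x ω - m) 2 P :=
  (hf.memLp_two x).sub (memLp_const m)

/-- The centred random variable `f x - m` as an element of `L²`. -/
noncomputable def IsStationaryIsotropicGRF.centered (hf : IsStationaryIsotropicGRF P N m C f)
    (x : EuclideanSpace ℝ (Fin N)) : Lp ℝ 2 P :=
  (hf.memLp_sub_mean x).toLp

theorem IsStationaryIsotropicGRF.coeFn_sum_smul_centered
    (hf : IsStationaryIsotropicGRF P N m C f) (c : EuclideanSpace ℝ (Fin N) →₀ ℝ) :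
    (c.sum fun x a => a • hf.centered x : Lp ℝ 2 P) =ᵐ[P]
      fun ω => (∑ x ∈ c.support, c x * f x ω) - ∑ x ∈ c.support, c x * m := by
  have h1 : ∀ᵐ ω ∂P, ∀ x ∈ c.support, (c x • hf.centered x : Lp ℝ 2 P) ω = c x * (f x ω - m) := by
    refine (ae_ball_iff c.support.countable_toSet).2 fun x _ => ?_
    filter_upwards [Lp.coeFn_smul (c x) (hf.centered x), (hf.memLp_sub_mean x).coeFn_toLp]
      with ω h1 h2
    rw [h1, Pi.smul_apply, smul_eq_mul, IsStationaryIsotropicGRF.centered, h2]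
  filter_upwards [h1, Lp.coeFn_finsetSum c.support fun x => c x • hf.centered x] with ω h1 h2
  rw [Finsupp.sum, h2, Finset.sum_apply, Finset.sum_congr rfl h1, ← Finset.sum_sub_distrib]
  exact Finset.sum_congr rfl fun x _ => by ring

theorem IsStationaryIsotropicGRF.variance_sum (hf : IsStationaryIsotropicGRF P N m C f)
    (c : EuclideanSpace ℝ (Fin N) →₀ ℝ) :
    Var[fun ω => ∑ x ∈ c.support, c x * f x ω; P] = ∑ x ∈ c.support, ∑ y ∈ c.support,
      c x * c y * (1 / (N : ℝ) * C (‖x - y‖₊ ^ 2 / 2)) := by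
  have hm : ∀ x ∈ c.support, MemLp (fun ω => c x * f x ω) 2 P := fun x _ =>
    (hf.memLp_two x).const_mul (c x)
  rw [← covariance_self (memLp_finsetSum c.support hm).aemeasurable,
    covariance_fun_sum_fun_sum' hm hm]
  simp_rw [covariance_const_mul_left, covariance_const_mul_right, hf.cov, mul_assoc]

theorem IsStationaryIsotropicGRF.isCenteredGaussian_sum (hf : IsStationaryIsotropicGRF P N m C f)
    (c : EuclideanSpace ℝ (Fin N) →₀ ℝ) :
    IsCenteredGaussian (c.sum fun x a => a • hf.centered x : Lp ℝ 2 P) ∧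
    ‖(c.sum fun x a => a • hf.centered x : Lp ℝ 2 P)‖ ^ 2 =
      ∑ x ∈ c.support, ∑ y ∈ c.support, c x * c y * (1 / (N : ℝ) * C (‖x - y‖₊ ^ 2 / 2)) := by
  set Y : Lp ℝ 2 P := c.sum fun x a => a • hf.centered x with hY
  set X : Ω → ℝ := fun ω => ∑ x ∈ c.support, c x * f x ω with hX
  set M : ℝ := ∑ x ∈ c.support, c x * m with hM
  have hYX : Y =ᵐ[P] fun ω => X ω - M := hf.coeFn_sum_smul_centered c
  have hXlaw : HasGaussianLaw X P := (hf.gaussian.smul c).hasGaussianLaw_fun_sum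
  have hXint : ∫ ω, X ω ∂P = M := by
    rw [hX, integral_finsetSum _ fun x _ =>
      ((hf.memLp_two x).integrable one_le_two).const_mul (c x)]
    simp_rw [integral_const_mul, hf.mean, hM]
  have hY0 : ∫ ω, Y ω ∂P = 0 := by
    rw [integral_congr_ae hYX, integral_sub hXlaw.integrable (integrable_const _), hXint]
    simp
  have hnorm : ‖Y‖ ^ 2 = Var[X; P] := by
    rw [Lp.sq_norm_eq_integral, variance_eq_integral hXlaw.aemeasurable, hXint]
    refine integral_congr_ae ?_
    filter_upwards [hYX] with ω h
    rw [h, Real.norm_eq_abs, sq_abs]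
  refine ⟨⟨hY0, ?_⟩, hnorm.trans (hf.variance_sum c)⟩
  have hmap : P.map (fun ω => X ω - M) = gaussianReal 0 Var[X; P].toNNReal := by
    have h1 := gaussianReal_map_sub_const (μ := M) (v := Var[X; P].toNNReal) M
    rw [sub_self] at h1
    rw [← h1, ← hXint, ← hXlaw.map_eq_gaussianReal, hXint,
      AEMeasurable.map_map_of_aemeasurable (by fun_prop) hXlaw.aemeasurable]
    rfl
  -- The cosine identity is the real part of the characteristic function at `1`.
  have hchar := charFun_gaussianReal (μ := 0) (v := Var[X; P].toNNReal) 1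
  rw [← hmap, charFun_apply_real, integral_map (hXlaw.aemeasurable.sub_const M)
    (by fun_prop), Real.coe_toNNReal _ (variance_nonneg X P), ← hnorm] at hchar
  have hint : Integrable (fun ω => Complex.exp (((1 : ℝ) : ℂ) * ((X ω - M : ℝ) : ℂ) * Complex.I)) P := by
    refine Integrable.of_bound ?_ 1 (Filter.Eventually.of_forall fun ω => ?_)
    · have := hXlaw.aemeasurable.aestronglyMeasurable
      fun_prop
    · rw [← Complex.ofReal_mul, Complex.norm_exp_ofReal_mul_I]
  have hre := congrArg Complex.re hchar
  rw [← RCLike.re_eq_complex_re, ← integral_re hint] at hre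
  rw [integral_congr_ae (g := fun ω => Real.cos (X ω - M)) (by
    filter_upwards [hYX] with ω h
    rw [h])]
  convert hre using 1
  · refine integral_congr_ae (Filter.Eventually.of_forall fun ω => ?_)
    simp only [Complex.ofReal_one, one_mul, RCLike.re_eq_complex_re,
      Complex.exp_ofReal_mul_I_re]
  · simp only [RCLike.re_eq_complex_re]
    rw [← Complex.exp_ofReal_re]
    congr 2
    push_cast
    ring

end Feature

section Continuity

open Filter Topology

variable {Ω : Type*} [MeasurableSpace Ω] {P : Measure Ω} [IsProbabilityMeasure P] {N : ℕ} {m : ℝ}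
  {C : ℝ≥0 → ℝ} {f : EuclideanSpace ℝ (Fin N) → Ω → ℝ}

theorem IsStationaryIsotropicGRF.isCenteredGaussian_of_mem_span
    (hf : IsStationaryIsotropicGRF P N m C f) {Y : Lp ℝ 2 P}
    (hY : Y ∈ Submodule.span ℝ (Set.range hf.centered)) : IsCenteredGaussian Y := by
  obtain ⟨c, rfl⟩ := Finsupp.mem_span_range_iff_exists_finsupp.1 hY
  exact (hf.isCenteredGaussian_sum c).1

theorem IsStationaryIsotropicGRF.inner_centered (hf : IsStationaryIsotropicGRF P N m C f)
    (x y : EuclideanSpace ℝ (Fin N)) :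
    inner ℝ (hf.centered x) (hf.centered y) = 1 / (N : ℝ) * C (‖x - y‖₊ ^ 2 / 2) := by
  rw [L2.inner_def, ← hf.cov, covariance, hf.mean, hf.mean]
  refine integral_congr_ae ?_
  filter_upwards [(hf.memLp_sub_mean x).coeFn_toLp, (hf.memLp_sub_mean y).coeFn_toLp] with ω h1 h2
  rw [IsStationaryIsotropicGRF.centered, IsStationaryIsotropicGRF.centered, h1, h2]
  simp [mul_comm]

theorem IsStationaryIsotropicGRF.continuous_centered (hf : IsStationaryIsotropicGRF P N m C f)
    (hcont : ∀ᵐ ω ∂P, Continuous fun x => f x ω) : Continuous hf.centered := by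
  refine continuous_iff_seqContinuous.2 fun u x hu => ?_
  have hmem : ∀ᵐ ω ∂P, ∀ n, hf.centered (u n) ω = f (u n) ω - m :=
    ae_all_iff.2 fun n => (hf.memLp_sub_mean (u n)).coeFn_toLp
  have hae : ∀ᵐ ω ∂P, Tendsto (fun n => hf.centered (u n) ω) atTop (𝓝 (f x ω - m)) := by
    filter_upwards [hcont, hmem] with ω h1 h2
    simp only [h2]
    exact ((h1.tendsto x).comp hu).sub_const m
  have hcau : CauchySeq fun n => hf.centered (u n) :=
    cauchySeq_of_isCenteredGaussian_sub (fun i j => hf.isCenteredGaussian_of_mem_span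
      (Submodule.sub_mem _ (Submodule.subset_span ⟨_, rfl⟩) (Submodule.subset_span ⟨_, rfl⟩))) hae
  obtain ⟨Z, hZ⟩ := cauchySeq_tendsto_of_complete hcau
  have hZx : Z = hf.centered x := Lp.ext
    ((Lp.ae_eq_of_tendsto_of_ae_tendsto hZ hae).trans (hf.memLp_sub_mean x).coeFn_toLp.symm)
  rwa [hZx] at hZ

theorem IsStationaryIsotropicGRF.continuous_kernel (hf : IsStationaryIsotropicGRF P N m C f)
    (hN : 1 ≤ N) (hcont : ∀ᵐ ω ∂P, Continuous fun x => f x ω) : Continuous C := by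
  have hN' : (N : ℝ) ≠ 0 := by exact_mod_cast (by omega : N ≠ 0)
  set p : ℝ≥0 → EuclideanSpace ℝ (Fin N) :=
    fun s => Real.sqrt (2 * s) • EuclideanSpace.single ⟨0, hN⟩ (1 : ℝ) with hp
  have hpc : Continuous p := by fun_prop
  have h1 : ∀ s, C s = N * inner ℝ (hf.centered (p s)) (hf.centered 0) := by
    intro s
    rw [hf.inner_centered, ← mul_assoc, mul_one_div_cancel hN', one_mul, sub_zero]
    congr 1
    ext
    push_cast
    rw [hp, norm_smul, PiLp.norm_single, norm_one, mul_one, Real.norm_eq_abs, sq_abs,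
      Real.sq_sqrt (by positivity)]
    ring
  rw [funext h1]
  exact continuous_const.mul (((hf.continuous_centered hcont).comp hpc).inner continuous_const)

/-- If `C` were constant, all increments would vanish in `L²`; almost surely the path would then be
constant on a countable dense set, hence everywhere by continuity. -/
theorem IsStationaryIsotropicGRF.exists_ne_of_not_ae_const
    (hf : IsStationaryIsotropicGRF P N m C f) (hcont : ∀ᵐ ω ∂P, Continuous fun x => f x ω)
    (hconst : ¬ ∀ᵐ ω ∂P, ∃ c : ℝ, ∀ x, f x ω = c) : ∃ s, C s ≠ C 0 := by
  by_contra! hC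
  refine hconst ?_
  have h1 : ∀ x, f x =ᵐ[P] f 0 := by
    intro x
    have h2 : hf.centered x = hf.centered 0 := by
      rw [← sub_eq_zero, ← inner_self_eq_zero (𝕜 := ℝ), inner_sub_left, inner_sub_right,
        inner_sub_right]
      simp only [hf.inner_centered, hC]
      ring
    have h3 := (hf.memLp_sub_mean x).coeFn_toLp
    have h4 := (hf.memLp_sub_mean 0).coeFn_toLp
    rw [IsStationaryIsotropicGRF.centered, IsStationaryIsotropicGRF.centered] at h2
    rw [h2] at h3
    filter_upwards [h3, h4] with ω h5 h6
    linarith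
  have h2 : ∀ᵐ ω ∂P, ∀ n, f (TopologicalSpace.denseSeq _ n) ω = f 0 ω := ae_all_iff.2 fun n => h1 _
  filter_upwards [hcont, h2] with ω h3 h4
  refine ⟨f 0 ω, fun x => ?_⟩
  exact congrFun (h3.ext_on (TopologicalSpace.denseRange_denseSeq _) continuous_const
    (by rintro _ ⟨n, rfl⟩; exact h4 n)) x

end Continuity

/-! ### The spectral isometry. -/

section SpectralSpan

open Filter Topology

variable {N : ℕ} (ρ : Measure (EuclideanSpace ℝ (Fin N))) [IsFiniteMeasure ρ]

theorem memLp_two_cexp_inner_mul_I (x : EuclideanSpace ℝ (Fin N)) :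
    MemLp (fun z => Complex.exp ((inner ℝ z x : ℝ) * Complex.I)) 2 ρ :=
  MemLp.of_bound (by fun_prop) 1 (Eventually.of_forall fun z => by
    rw [Complex.norm_exp_ofReal_mul_I])

/-- The character `z ↦ exp(i ⟨z, x⟩)` as an element of `L²`. -/
noncomputable def spectralFeature (x : EuclideanSpace ℝ (Fin N)) : Lp ℂ 2 ρ :=
  (memLp_two_cexp_inner_mul_I ρ x).toLp

theorem sq_norm_sum_smul_spectralFeature {K : EuclideanSpace ℝ (Fin N) → ℝ}
    (hK : ∀ x, charFun ρ x = (K x : ℂ)) (c : EuclideanSpace ℝ (Fin N) →₀ ℝ) :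
    ‖(c.sum fun x a => a • spectralFeature ρ x : Lp ℂ 2 ρ)‖ ^ 2 =
      ∑ x ∈ c.support, ∑ y ∈ c.support, c x * c y * K (x - y) := by
  set e : EuclideanSpace ℝ (Fin N) → EuclideanSpace ℝ (Fin N) → ℂ :=
    fun x z => Complex.exp ((inner ℝ z x : ℝ) * Complex.I) with he
  have h1 : ∀ᵐ z ∂ρ, ∀ x ∈ c.support, (c x • spectralFeature ρ x : Lp ℂ 2 ρ) z = c x * e x z := by
    refine (ae_ball_iff c.support.countable_toSet).2 fun x _ => ?_
    filter_upwards [Lp.coeFn_smul (c x) (spectralFeature ρ x),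
      (memLp_two_cexp_inner_mul_I ρ x).coeFn_toLp] with z h1 h2
    rw [h1, Pi.smul_apply, Complex.real_smul, spectralFeature, h2]
  have h2 : ∀ z, ((‖∑ x ∈ c.support, c x * e x z‖ ^ 2 : ℝ) : ℂ) =
      ∑ x ∈ c.support, ∑ y ∈ c.support, (c x * c y : ℂ) * e (x - y) z := by
    intro z
    rw [Complex.ofReal_pow, ← Complex.mul_conj', map_sum, Finset.sum_mul_sum]
    refine Finset.sum_congr rfl fun x _ => Finset.sum_congr rfl fun y _ => ?_
    rw [map_mul, Complex.conj_ofReal, he]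
    simp only
    rw [← Complex.exp_conj, map_mul, Complex.conj_I, Complex.conj_ofReal, inner_sub_right,
      mul_mul_mul_comm, ← Complex.exp_add]
    congr 2
    push_cast
    ring
  have hint : ∀ x, Integrable (e x) ρ := fun x =>
    (memLp_two_cexp_inner_mul_I ρ x).integrable one_le_two
  apply Complex.ofReal_injective
  rw [Lp.sq_norm_eq_integral, ← integral_complex_ofReal]
  have h3 : ∀ᵐ z ∂ρ, ((‖(c.sum fun x a => a • spectralFeature ρ x : Lp ℂ 2 ρ) z‖ ^ 2 : ℝ) : ℂ) =
      ∑ x ∈ c.support, ∑ y ∈ c.support, (c x * c y : ℂ) * e (x - y) z := by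
    filter_upwards [h1, Lp.coeFn_finsetSum c.support fun x => c x • spectralFeature ρ x]
      with z h4 h5
    rw [Finsupp.sum, h5, Finset.sum_apply, Finset.sum_congr rfl h4, h2]
  rw [integral_congr_ae h3, integral_finsetSum _ fun x _ => integrable_finsetSum _ fun y _ =>
    (hint _).const_mul _]
  push_cast
  refine Finset.sum_congr rfl fun x _ => ?_
  rw [integral_finsetSum _ fun y _ => (hint _).const_mul _]
  refine Finset.sum_congr rfl fun y _ => ?_
  rw [integral_const_mul, ← hK, charFun_apply]

variable {Ω : Type*} [MeasurableSpace Ω] {P : Measure Ω} [IsProbabilityMeasure P] {m : ℝ}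
  {C : ℝ≥0 → ℝ} {f : EuclideanSpace ℝ (Fin N) → Ω → ℝ}

/-- The graph of the spectral isometry: the closed span of the pairs consisting of `f x - m` and
the character of `x`. -/
noncomputable def IsStationaryIsotropicGRF.spectralGraph
    (hf : IsStationaryIsotropicGRF P N m C f) : Submodule ℝ (Lp ℝ 2 P × Lp ℂ 2 ρ) :=
  (Submodule.span ℝ (Set.range fun x => (hf.centered x, spectralFeature ρ x))).topologicalClosure

variable {ρ}

theorem IsStationaryIsotropicGRF.mem_spectralGraph (hf : IsStationaryIsotropicGRF P N m C f)
    (x : EuclideanSpace ℝ (Fin N)) : (hf.centered x, spectralFeature ρ x) ∈ hf.spectralGraph ρ :=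
  Submodule.le_topologicalClosure _ (Submodule.subset_span ⟨x, rfl⟩)

/-- Both properties are closed, so it suffices to check finite combinations, where both squared
norms are the same quadratic form in the covariance. -/
theorem IsStationaryIsotropicGRF.isCenteredGaussian_and_norm_eq
    (hf : IsStationaryIsotropicGRF P N m C f)
    (hρ : ∀ x, charFun ρ x = ((1 / (N : ℝ) * C (‖x‖₊ ^ 2 / 2) : ℝ) : ℂ))
    {g : Lp ℝ 2 P × Lp ℂ 2 ρ} (hg : g ∈ hf.spectralGraph ρ) :
    IsCenteredGaussian g.1 ∧ ‖g.1‖ = ‖g.2‖ := by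
  have hclosed : IsClosed {g : Lp ℝ 2 P × Lp ℂ 2 ρ | IsCenteredGaussian g.1 ∧ ‖g.1‖ = ‖g.2‖} :=
    (isClosed_setOf_isCenteredGaussian.preimage continuous_fst).inter
      (isClosed_eq (by fun_prop) (by fun_prop))
  refine closure_minimal ?_ hclosed hg
  intro g hg
  obtain ⟨c, rfl⟩ := Finsupp.mem_span_range_iff_exists_finsupp.1 hg
  have h1 : (c.sum fun x a => a • (hf.centered x, spectralFeature ρ x)).1 =
      c.sum fun x a => a • hf.centered x := by
    simp [Finsupp.sum, Prod.fst_sum]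
  have h2 : (c.sum fun x a => a • (hf.centered x, spectralFeature ρ x)).2 =
      c.sum fun x a => a • spectralFeature ρ x := by
    simp [Finsupp.sum, Prod.snd_sum]
  have h3 := hf.isCenteredGaussian_sum c
  refine ⟨by rw [h1]; exact h3.1, ?_⟩
  rw [h1, h2, ← sq_eq_sq₀ (norm_nonneg _) (norm_nonneg _), h3.2,
    sq_norm_sum_smul_spectralFeature ρ hρ]

/-- Almost sure convergence makes the first components Cauchy in `L²(P)`, and the isometry passes
this on to the second. Square integrability of `y` and `φ` is thus a conclusion. -/
theorem IsStationaryIsotropicGRF.exists_mem_spectralGraph_of_tendsto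
    (hf : IsStationaryIsotropicGRF P N m C f)
    (hρ : ∀ x, charFun ρ x = ((1 / (N : ℝ) * C (‖x‖₊ ^ 2 / 2) : ℝ) : ℂ))
    {g : ℕ → Lp ℝ 2 P × Lp ℂ 2 ρ} (hg : ∀ n, g n ∈ hf.spectralGraph ρ) {y : Ω → ℝ}
    {φ : EuclideanSpace ℝ (Fin N) → ℂ}
    (hy : ∀ᵐ ω ∂P, Tendsto (fun n => (g n).1 ω) atTop (𝓝 (y ω)))
    (hφ : ∀ᵐ z ∂ρ, Tendsto (fun n => (g n).2 z) atTop (𝓝 (φ z))) :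
    ∃ G ∈ hf.spectralGraph ρ, G.1 =ᵐ[P] y ∧ G.2 =ᵐ[ρ] φ := by
  have hsub : ∀ i j, g i - g j ∈ hf.spectralGraph ρ := fun i j => Submodule.sub_mem _ (hg i) (hg j)
  have h1 : CauchySeq fun n => (g n).1 := cauchySeq_of_isCenteredGaussian_sub
    (fun i j => (hf.isCenteredGaussian_and_norm_eq hρ (hsub i j)).1) hy
  have h2 : CauchySeq fun n => (g n).2 := by
    rw [cauchySeq_iff_tendsto_dist_atTop_0] at h1 ⊢
    refine h1.congr fun p => ?_
    rw [dist_eq_norm, dist_eq_norm]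
    exact (hf.isCenteredGaussian_and_norm_eq hρ (hsub p.1 p.2)).2
  obtain ⟨Y, hY⟩ := cauchySeq_tendsto_of_complete h1
  obtain ⟨Φ, hΦ⟩ := cauchySeq_tendsto_of_complete h2
  refine ⟨(Y, Φ), ?_, Lp.ae_eq_of_tendsto_of_ae_tendsto hY hy,
    Lp.ae_eq_of_tendsto_of_ae_tendsto hΦ hφ⟩
  exact (Submodule.isClosed_topologicalClosure _).mem_of_tendsto (hY.prodMk_nhds hΦ)
    (Eventually.of_forall hg)

end SpectralSpan

/-! ### Partial derivatives on the spectral side. -/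

section Derivatives

open Filter Topology

variable {N : ℕ}

/-- The derivative `∂_{i₁} ⋯ ∂_{iₗ}` in `x` of the character `z ↦ exp(i ⟨z, x⟩)`. -/
noncomputable def spectralSymbol (l : List (Fin N)) (x z : EuclideanSpace ℝ (Fin N)) : ℂ :=
  (l.map fun i => (z i : ℂ) * Complex.I).prod * Complex.exp ((inner ℝ z x : ℝ) * Complex.I)

theorem continuous_spectralSymbol (l : List (Fin N)) (x : EuclideanSpace ℝ (Fin N)) :
    Continuous (spectralSymbol l x) := by
  refine Continuous.mul ?_ (by fun_prop)
  exact continuous_list_prod _ fun i _ => by fun_prop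

theorem tendsto_slope_spectralSymbol (l : List (Fin N)) (i : Fin N)
    (x z : EuclideanSpace ℝ (Fin N)) :
    Tendsto (fun t : ℝ => t⁻¹ • (spectralSymbol l (x + t • EuclideanSpace.single i 1) z -
      spectralSymbol l x z)) (𝓝[≠] 0) (𝓝 (spectralSymbol (i :: l) x z)) := by
  have h1 : HasDerivAt (fun t : ℝ => spectralSymbol l (x + t • EuclideanSpace.single i 1) z)
      (spectralSymbol (i :: l) x z) 0 := by
    unfold spectralSymbol
    have h2 : HasDerivAt (fun t : ℝ => ((inner ℝ z (x + t • EuclideanSpace.single i 1) : ℝ) : ℂ) *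
        Complex.I) ((z i : ℂ) * Complex.I) 0 := by
      refine HasDerivAt.mul_const (HasDerivAt.ofReal_comp ?_) _
      simp only [inner_add_right, inner_smul_right]
      have : inner ℝ z (EuclideanSpace.single i (1 : ℝ)) = z i := by
        simp [EuclideanSpace.inner_single_right]
      rw [this]
      simpa using ((hasDerivAt_id (0 : ℝ)).mul_const (z i)).const_add (inner ℝ z x)
    have h3 := (h2.cexp).const_mul (l.map fun i => (z i : ℂ) * Complex.I).prod
    refine h3.congr_deriv ?_
    rw [zero_smul, add_zero, List.map_cons, List.prod_cons]
    ring
  have h4 := h1.tendsto_slope_zero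
  simpa using h4

variable {ρ : Measure (EuclideanSpace ℝ (Fin N))} [IsFiniteMeasure ρ]
  {Ω : Type*} [MeasurableSpace Ω] {P : Measure Ω} [IsProbabilityMeasure P] {m : ℝ}
  {C : ℝ≥0 → ℝ} {f : EuclideanSpace ℝ (Fin N) → Ω → ℝ}

/-- Induction on the word: difference quotients stay in the closed graph and converge pointwise on
both sides. The constant `c` must not depend on `x`, so that it cancels in the next quotient. -/
theorem IsStationaryIsotropicGRF.exists_mem_spectralGraph_partialDeriv
    (hf : IsStationaryIsotropicGRF P N m C f)
    (hρ : ∀ x, charFun ρ x = ((1 / (N : ℝ) * C (‖x‖₊ ^ 2 / 2) : ℝ) : ℂ)) {k : ℕ}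
    (hk : ∀ᵐ ω ∂P, HasPartialDerivsUpTo k fun x => f x ω) (l : List (Fin N)) (hl : l.length ≤ k) :
    ∃ c : ℝ, ∀ x, ∃ G ∈ hf.spectralGraph ρ,
      G.1 =ᵐ[P] (fun ω => partialDeriv l (fun y => f y ω) x - c) ∧
      G.2 =ᵐ[ρ] spectralSymbol l x := by
  induction l with
  | nil =>
    refine ⟨m, fun x => ⟨_, hf.mem_spectralGraph x, (hf.memLp_sub_mean x).coeFn_toLp, ?_⟩⟩
    refine (memLp_two_cexp_inner_mul_I ρ x).coeFn_toLp.trans (Eventually.of_forall fun z => ?_)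
    simp [spectralSymbol]
  | cons i l ih =>
    obtain ⟨c, hc⟩ := ih (Nat.le_of_succ_le hl)
    choose G hG hG1 hG2 using hc
    refine ⟨0, fun x => ?_⟩
    set h : ℕ → ℝ := fun n => 1 / ((n : ℝ) + 1) with hh
    have hlim : Tendsto h atTop (𝓝[≠] 0) := by
      refine tendsto_nhdsWithin_iff.2 ⟨tendsto_one_div_add_atTop_nhds_zero_nat,
        Eventually.of_forall fun n => ?_⟩
      simp only [hh, Set.mem_compl_iff, Set.mem_singleton_iff]
      positivity
    set u : ℕ → EuclideanSpace ℝ (Fin N) := fun n => x + h n • EuclideanSpace.single i 1 with hu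
    refine hf.exists_mem_spectralGraph_of_tendsto hρ
      (g := fun n => (h n)⁻¹ • (G (u n) - G x))
      (fun n => Submodule.smul_mem _ _ (Submodule.sub_mem _ (hG _) (hG _))) ?_ ?_
    · have h1 : ∀ᵐ ω ∂P, ∀ n, ((h n)⁻¹ • (G (u n) - G x)).1 ω = (h n)⁻¹ •
          (partialDeriv l (fun y => f y ω) (u n) - partialDeriv l (fun y => f y ω) x) := by
        refine ae_all_iff.2 fun n => ?_
        filter_upwards [Lp.coeFn_smul (h n)⁻¹ ((G (u n)).1 - (G x).1),
          Lp.coeFn_sub (G (u n)).1 (G x).1, hG1 (u n), hG1 x] with ω h2 h3 h4 h5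
        rw [Prod.smul_fst, Prod.fst_sub, h2, Pi.smul_apply, h3, Pi.sub_apply, h4, h5]
        congr 1
        ring
      filter_upwards [h1, hk] with ω h2 h3
      simp only [h2, sub_zero]
      have h4 := (h3 l hl i x).hasLineDerivAt
      have h5 := (HasLineDerivAt.tendsto_slope_zero h4).comp hlim
      exact h5
    · have h1 : ∀ᵐ z ∂ρ, ∀ n, ((h n)⁻¹ • (G (u n) - G x)).2 z = (h n)⁻¹ •
          (spectralSymbol l (u n) z - spectralSymbol l x z) := by
        refine ae_all_iff.2 fun n => ?_
        filter_upwards [Lp.coeFn_smul (h n)⁻¹ ((G (u n)).2 - (G x).2),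
          Lp.coeFn_sub (G (u n)).2 (G x).2, hG2 (u n), hG2 x] with ω h2 h3 h4 h5
        rw [Prod.smul_snd, Prod.snd_sub, h2, Pi.smul_apply, h3, Pi.sub_apply, h4, h5]
      filter_upwards [h1] with z h2
      simp only [h2]
      exact (tendsto_slope_spectralSymbol l i x z).comp hlim

theorem IsStationaryIsotropicGRF.memLp_partialDeriv
    (hf : IsStationaryIsotropicGRF P N m C f)
    (hρ : ∀ x, charFun ρ x = ((1 / (N : ℝ) * C (‖x‖₊ ^ 2 / 2) : ℝ) : ℂ)) {k : ℕ}
    (hk : ∀ᵐ ω ∂P, HasPartialDerivsUpTo k fun x => f x ω) (l : List (Fin N)) (hl : l.length ≤ k)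
    (x : EuclideanSpace ℝ (Fin N)) :
    MemLp (fun ω => partialDeriv l (fun y => f y ω) x) 2 P := by
  obtain ⟨c, hc⟩ := hf.exists_mem_spectralGraph_partialDeriv hρ hk l hl
  obtain ⟨G, -, hG1, -⟩ := hc x
  refine MemLp.ae_eq ?_ ((Lp.memLp G.1).add (memLp_const c))
  filter_upwards [hG1] with ω h
  simp [h]

/-- Zero variance makes the combination constant, centring makes it zero, and the isometry makes its
symbol zero in `L²(ρ)`. Full support upgrades this to every `z`, the symbol being continuous. -/
theorem IsStationaryIsotropicGRF.sum_spectralSymbol_eq_zero [ρ.IsOpenPosMeasure]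
    (hf : IsStationaryIsotropicGRF P N m C f)
    (hρ : ∀ x, charFun ρ x = ((1 / (N : ℝ) * C (‖x‖₊ ^ 2 / 2) : ℝ) : ℂ)) {k : ℕ}
    (hk : ∀ᵐ ω ∂P, HasPartialDerivsUpTo k fun x => f x ω) {ι : Type*} (s : Finset ι) (w : ι → ℝ)
    (l : ι → List (Fin N)) (hl : ∀ i, (l i).length ≤ k) (x : ι → EuclideanSpace ℝ (Fin N))
    (hvar : Var[fun ω => ∑ i ∈ s, w i * partialDeriv (l i) (fun y => f y ω) (x i); P] = 0)
    (z : EuclideanSpace ℝ (Fin N)) : ∑ i ∈ s, (w i : ℂ) * spectralSymbol (l i) (x i) z = 0 := by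
  choose c hc using fun i => hf.exists_mem_spectralGraph_partialDeriv hρ hk (l i) (hl i)
  choose G hG hG1 hG2 using fun i => hc i (x i)
  have hmem : ∑ i ∈ s, w i • G i ∈ hf.spectralGraph ρ :=
    Submodule.sum_mem _ fun i _ => Submodule.smul_mem _ _ (hG i)
  obtain ⟨hgauss, hnorm⟩ := hf.isCenteredGaussian_and_norm_eq hρ hmem
  rw [Prod.fst_sum, Prod.snd_sum] at hnorm
  rw [Prod.fst_sum] at hgauss
  simp only [Prod.smul_fst, Prod.smul_snd] at hgauss hnorm
  set Y : Lp ℝ 2 P := ∑ i ∈ s, w i • (G i).1 with hY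
  have h1 : ∀ᵐ ω ∂P, ∀ i ∈ s, (w i • (G i).1 : Lp ℝ 2 P) ω =
      w i * (partialDeriv (l i) (fun y => f y ω) (x i) - c i) := by
    refine (ae_ball_iff s.countable_toSet).2 fun i _ => ?_
    filter_upwards [Lp.coeFn_smul (w i) (G i).1, hG1 i] with ω h1 h2
    rw [h1, Pi.smul_apply, smul_eq_mul, h2]
  have h2 : ∀ᵐ z ∂ρ, ∀ i ∈ s, (w i • (G i).2 : Lp ℂ 2 ρ) z = w i * spectralSymbol (l i) (x i) z := by
    refine (ae_ball_iff s.countable_toSet).2 fun i _ => ?_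
    filter_upwards [Lp.coeFn_smul (w i) (G i).2, hG2 i] with ω h1 h2
    rw [h1, Pi.smul_apply, Complex.real_smul, h2]
  have h3 := ae_eq_integral_of_variance_eq_zero (memLp_finsetSum s fun i _ =>
    (hf.memLp_partialDeriv hρ hk (l i) (hl i) (x i)).const_mul (w i)) hvar
  obtain ⟨a, ha⟩ : ∃ a : ℝ, ∀ᵐ ω ∂P, Y ω = a := by
    refine ⟨(∫ ω, ∑ i ∈ s, w i * partialDeriv (l i) (fun y => f y ω) (x i) ∂P) -
      ∑ i ∈ s, w i * c i, ?_⟩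
    filter_upwards [h1, h3, Lp.coeFn_fun_finsetSum s fun i => w i • (G i).1] with ω h4 h5 h6
    rw [hY, h6, Finset.sum_congr rfl h4, ← h5]
    simp only [mul_sub, Finset.sum_sub_distrib]
  have ha0 : a = 0 := by
    have := hgauss.integral_eq_zero
    rw [integral_congr_ae ha] at this
    simpa using this
  have hY0 : Y = 0 := by
    refine Lp.ext ?_
    filter_upwards [ha, Lp.coeFn_zero ℝ 2 P] with ω h4 h5
    rw [h4, h5, ha0, Pi.zero_apply]
  rw [hY0, norm_zero, eq_comm, norm_eq_zero] at hnorm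
  have h4 : (fun z => ∑ i ∈ s, (w i : ℂ) * spectralSymbol (l i) (x i) z) =ᵐ[ρ] fun _ => 0 := by
    have h5 := Lp.coeFn_fun_finsetSum s fun i => w i • (G i).2
    rw [hnorm] at h5
    filter_upwards [h2, h5, Lp.coeFn_zero ℂ 2 ρ] with z h6 h7 h8
    rw [h8] at h7
    rw [← Finset.sum_congr rfl h6, ← h7]
    rfl
  exact congrFun (Continuous.ae_eq_iff_eq ρ (continuous_finsetSum s fun i _ =>
    continuous_const.mul (continuous_spectralSymbol (l i) (x i))) continuous_const |>.1 h4) z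

end Derivatives

/-! ### Linear independence of exponential polynomials. -/

section ExponentialPolynomials

open Polynomial in
-- Each summand, as a sequence in `n`, is a generalised eigenvector of the shift for the eigenvalue
-- `μ j`, and generalised eigenspaces for distinct eigenvalues are independent.
theorem Polynomial.eq_zero_of_sum_eval_mul_pow_eq_zero {ι : Type*} [Fintype ι] {μ : ι → ℂ}
    (hμ : Function.Injective μ) (hμ0 : ∀ j, μ j ≠ 0) (p : ι → ℂ[X])
    (h : ∀ n : ℕ, ∑ j, (p j).eval (n : ℂ) * μ j ^ n = 0) (j : ι) : p j = 0 := by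
  set T : Module.End ℂ (ℕ → ℂ) := LinearMap.funLeft ℂ ℂ Nat.succ with hT
  -- On `q(n) * a ^ n` the operator `T - a` acts as `a` times the forward difference on `q`, hence
  -- nilpotently.
  have hpow : ∀ (a : ℂ) (q : ℂ[X]) (k : ℕ),
      ((T - a • (1 : Module.End ℂ (ℕ → ℂ))) ^ k) (fun n : ℕ => q.eval (n : ℂ) * a ^ n) =
        fun n : ℕ => a ^ k * (((fwdDiff 1)^[k] q.eval) (n : ℂ) * a ^ n) := by
    intro a q k
    induction k with
    | zero => simp
    | succ k ih =>
      rw [pow_succ', Module.End.mul_apply, ih]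
      ext n
      simp only [LinearMap.sub_apply, LinearMap.smul_apply, Module.End.one_apply, Pi.sub_apply,
        Pi.smul_apply, smul_eq_mul, hT, LinearMap.funLeft_apply, Function.iterate_succ_apply',
        fwdDiff, Nat.succ_eq_add_one, Nat.cast_add, Nat.cast_one]
      ring
  have hmem : ∀ j, (fun n : ℕ => (p j).eval (n : ℂ) * μ j ^ n) ∈ T.maxGenEigenspace (μ j) := by
    intro j
    rw [Module.End.mem_maxGenEigenspace]
    refine ⟨(p j).natDegree + 1, ?_⟩
    rw [hpow, Polynomial.fwdDiff_iter_degree_add_one_eq_zero]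
    ext n
    simp
  have hind := T.independent_maxGenEigenspace.comp hμ
  have h0 := (iSupIndep_iff_finsetSum_eq_zero_imp_eq_zero _).1 hind Finset.univ
    (fun j n => (p j).eval (n : ℂ) * μ j ^ n) (fun j _ => hmem j) (by
      ext n
      simpa using h n) j (Finset.mem_univ j)
  refine Polynomial.eq_zero_of_infinite_isRoot _ (Set.infinite_of_injective_forall_mem
    (f := fun n : ℕ => (n : ℂ)) Nat.cast_injective fun n => ?_)
  have h1 := congrFun h0 n
  simpa [hμ0 j] using h1

variable {N : ℕ}

/-- A generic direction separates the points. Scaling it brings all inner products into `(-1, 1)`,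
where `θ ↦ exp(iθ)` is injective. -/
theorem exists_injective_cexp_inner {n : ℕ} {x : Fin n → EuclideanSpace ℝ (Fin N)}
    (hx : Function.Injective x) : ∃ v : EuclideanSpace ℝ (Fin N),
      Function.Injective fun j => Complex.exp ((inner ℝ v (x j) : ℝ) * Complex.I) := by
  obtain ⟨v, hv⟩ := Module.Dual.exists_forall_ne_zero_of_forall_exists (K := ℝ)
    (fun p : {p : Fin n × Fin n // p.1 ≠ p.2} =>
      (innerₗ (EuclideanSpace ℝ (Fin N)) (x p.1.1 - x p.1.2)))
    (fun p => ⟨x p.1.1 - x p.1.2, by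
      rw [innerₗ_apply_apply]
      exact inner_self_ne_zero.2 (sub_ne_zero.2 (hx.ne p.2))⟩)
  set R : ℝ := 1 + ∑ j, |inner ℝ v (x j)| with hR
  have hR0 : 0 < R := by positivity
  refine ⟨R⁻¹ • v, fun i j hij => ?_⟩
  have hb : ∀ j, |inner ℝ (R⁻¹ • v) (x j)| < 1 := by
    intro j
    rw [real_inner_smul_left, abs_mul, abs_of_pos (inv_pos.2 hR0), inv_mul_lt_iff₀ hR0, mul_one]
    have := Finset.single_le_sum (f := fun j => |inner ℝ v (x j)|) (fun _ _ => abs_nonneg _)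
      (Finset.mem_univ j)
    linarith
  have him : ∀ j, (((inner ℝ (R⁻¹ • v) (x j) : ℝ) : ℂ) * Complex.I).im =
      inner ℝ (R⁻¹ • v) (x j) := fun j => by simp
  have hpi := Real.pi_gt_three
  have h1 := Complex.exp_inj_of_neg_pi_lt_of_le_pi
    (by rw [him]; linarith [(abs_lt.1 (hb i)).1]) (by rw [him]; linarith [(abs_lt.1 (hb i)).2])
    (by rw [him]; linarith [(abs_lt.1 (hb j)).1]) (by rw [him]; linarith [(abs_lt.1 (hb j)).2]) hij
  have h2 := congrArg Complex.im h1
  rw [him, him, real_inner_smul_left, real_inner_smul_left] at h2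
  have h3 := mul_left_cancel₀ (inv_pos.2 hR0).ne' h2
  by_contra hne
  refine hv ⟨(i, j), hne⟩ ?_
  rw [innerₗ_apply_apply, real_inner_comm, inner_sub_right, h3, sub_self]

/-- Along the points `z + m v` with `m` natural, each summand is a polynomial in `m` times the
`m`-th power of `exp(i⟨v, xⱼ⟩)`, and these bases are distinct. The one-variable case applies, and `m
= 0` recovers the value at `z`. -/
theorem MvPolynomial.eq_zero_of_sum_eval_mul_cexp_eq_zero {n : ℕ}
    {x : Fin n → EuclideanSpace ℝ (Fin N)} (hx : Function.Injective x)
    (p : Fin n → MvPolynomial (Fin N) ℂ)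
    (h : ∀ z : EuclideanSpace ℝ (Fin N), ∑ j, MvPolynomial.eval (fun i => (z i : ℂ)) (p j) *
      Complex.exp ((inner ℝ z (x j) : ℝ) * Complex.I) = 0) (j : Fin n) : p j = 0 := by
  obtain ⟨v, hv⟩ := exists_injective_cexp_inner hx
  have hz : ∀ z : EuclideanSpace ℝ (Fin N), MvPolynomial.eval (fun i => (z i : ℂ)) (p j) = 0 := by
    intro z
    set q : Fin n → Polynomial ℂ := fun j =>
      Polynomial.C (Complex.exp ((inner ℝ z (x j) : ℝ) * Complex.I)) *
        MvPolynomial.aeval (fun i => Polynomial.C (z i : ℂ) + Polynomial.X * Polynomial.C (v i : ℂ))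
          (p j) with hq
    have hqe : ∀ (s : ℂ) (j : Fin n), (q j).eval s =
        Complex.exp ((inner ℝ z (x j) : ℝ) * Complex.I) *
          MvPolynomial.eval (fun i => (z i : ℂ) + s * (v i : ℂ)) (p j) := by
      intro s j
      rw [hq, Polynomial.eval_mul, Polynomial.eval_C]
      congr 1
      induction p j using MvPolynomial.induction_on with
      | C a => simp
      | add p₁ p₂ h₁ h₂ => rw [map_add, Polynomial.eval_add, h₁, h₂, map_add]
      | mul_X p₁ i h₁ =>
        rw [map_mul, Polynomial.eval_mul, h₁, map_mul]
        simp [-Polynomial.X_mul_C]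
    have h0 := Polynomial.eq_zero_of_sum_eval_mul_pow_eq_zero hv (fun _ => Complex.exp_ne_zero _) q
      (fun m => by
        rw [← h (z + (m : ℝ) • v)]
        refine Finset.sum_congr rfl fun j _ => ?_
        rw [hqe, inner_add_left, real_inner_smul_left, ← Complex.exp_nat_mul]
        push_cast
        rw [add_mul, Complex.exp_add, mul_assoc (m : ℂ)]
        simp only [PiLp.add_apply, PiLp.smul_apply, smul_eq_mul, Complex.ofReal_add,
          Complex.ofReal_mul, Complex.ofReal_natCast]
        ring) j
    have h1 := hqe 0 j
    rw [h0] at h1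
    simpa using h1.symm
  -- A complex polynomial vanishing at all real points is zero.
  refine MvPolynomial.funext_set (fun _ => Set.range ((↑) : ℝ → ℂ))
    (fun _ => Set.infinite_range_of_injective Complex.ofReal_injective) fun y hy => ?_
  choose r hr using fun i => hy i (Set.mem_univ i)
  have := hz (WithLp.toLp 2 r)
  simp only [hr] at this
  simpa using this

/-- A sorted word is determined by its multiset of letters. This is why each mixed partial must be
listed only once. -/
theorem toFinsupp_ofFn_injective {k : ℕ} : Function.Injective fun a : DerivIndex N k =>
    Multiset.toFinsupp ((List.ofFn a.2.1 : List (Fin N)) : Multiset (Fin N)) := by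
  rintro ⟨⟨l, hl⟩, ⟨i, hi⟩⟩ ⟨⟨l', hl'⟩, ⟨i', hi'⟩⟩ h
  have h1 := Multiset.coe_eq_coe.1 (Multiset.toFinsupp.injective h)
  have h2 := List.Perm.eq_of_sortedLE hi.sortedLE_ofFn hi'.sortedLE_ofFn h1
  have h3 := List.ofFn_inj'.1 h2
  simp only [Sigma.mk.injEq] at h3
  obtain ⟨rfl, h4⟩ := h3
  obtain rfl := eq_of_heq h4
  rfl

theorem MvPolynomial.prod_map_X_eq_monomial (l : List (Fin N)) :
    (l.map fun i => (MvPolynomial.X i : MvPolynomial (Fin N) ℂ)).prod =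
      MvPolynomial.monomial (Multiset.toFinsupp (l : Multiset (Fin N))) 1 := by
  induction l with
  | nil => simp
  | cons i l ih =>
    rw [List.map_cons, List.prod_cons, ih, ← Multiset.cons_coe, ← Multiset.singleton_add,
      Multiset.toFinsupp_add, Multiset.toFinsupp_singleton, MvPolynomial.X,
      MvPolynomial.monomial_mul, one_mul]

theorem spectralSymbol_eq_eval_monomial (l : List (Fin N)) (x z : EuclideanSpace ℝ (Fin N)) :
    spectralSymbol l x z = MvPolynomial.eval (fun i => (z i : ℂ))
      (MvPolynomial.monomial (Multiset.toFinsupp (l : Multiset (Fin N)))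
        (Complex.I ^ l.length)) * Complex.exp ((inner ℝ z x : ℝ) * Complex.I) := by
  rw [spectralSymbol, ← mul_one (Complex.I ^ l.length), ← MvPolynomial.C_mul_monomial,
    ← MvPolynomial.prod_map_X_eq_monomial, map_mul, MvPolynomial.eval_C, List.prod_map_mul]
  simp [map_list_prod, Function.comp_def, mul_comm]

end ExponentialPolynomials

/-! ### Strict positive definiteness. -/

theorem mainTheorem4 (C : ℝ≥0 → ℝ) (hC : ValidInAllDimensions C)
    {Ω : Type*} [MeasurableSpace Ω] (P : Measure Ω) [IsProbabilityMeasure P]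
    (N : ℕ) (hN : 1 ≤ N) (m : ℝ) (f : EuclideanSpace ℝ (Fin N) → Ω → ℝ)
    (hf : IsStationaryIsotropicGRF P N m C f)
    (hcont : ∀ᵐ ω ∂P, Continuous fun x => f x ω)
    (hconst : ¬ ∀ᵐ ω ∂P, ∃ c : ℝ, ∀ x, f x ω = c)
    (k : ℕ) (hk : ∀ᵐ ω ∂P, HasPartialDerivsUpTo k fun x => f x ω) :
    IsStrictlyPosDef P (derivVector k f) := by
  obtain ⟨ρ, _, _, hρ⟩ := hC.exists_spectralMeasure (hf.continuous_kernel hN hcont)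
    (hf.exists_ne_of_not_ae_const hcont hconst) hN
  have hlen : ∀ a : DerivIndex N k, (List.ofFn a.2.1).length ≤ k := fun a => by
    rw [List.length_ofFn]
    exact Nat.lt_succ_iff.1 a.1.2
  refine ⟨fun x a => hf.memLp_partialDeriv hρ hk _ (hlen a) x, fun n x w hx hvar j => ?_⟩
  have hvar' : Var[fun ω => ∑ p : Fin n × DerivIndex N k, w p.1 p.2 *
      partialDeriv (List.ofFn p.2.2.1) (fun y => f y ω) (x p.1); P] = 0 := by
    simp_rw [Fintype.sum_prod_type]
    exact hvar
  have hsum := hf.sum_spectralSymbol_eq_zero hρ hk Finset.univ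
    (fun p : Fin n × DerivIndex N k => w p.1 p.2) (fun p => List.ofFn p.2.2.1)
    (fun p => hlen p.2) (fun p => x p.1) hvar'
  -- The polynomial factor of the character of `x j` in the vanishing symbol.
  set q : Fin n → MvPolynomial (Fin N) ℂ := fun j => ∑ a : DerivIndex N k,
    MvPolynomial.monomial (Multiset.toFinsupp ((List.ofFn a.2.1 : List (Fin N)) :
      Multiset (Fin N))) ((w j a : ℂ) * Complex.I ^ (List.ofFn a.2.1).length) with hq
  have hq0 : q j = 0 := by
    refine MvPolynomial.eq_zero_of_sum_eval_mul_cexp_eq_zero hx q (fun z => ?_) j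
    rw [← hsum z, Fintype.sum_prod_type]
    refine Finset.sum_congr rfl fun j _ => ?_
    rw [hq, map_sum, Finset.sum_mul]
    refine Finset.sum_congr rfl fun a _ => ?_
    rw [spectralSymbol_eq_eval_monomial, ← MvPolynomial.C_mul_monomial, map_mul,
      MvPolynomial.eval_C, mul_assoc]
  ext a
  have h1 := congrArg (MvPolynomial.coeff (Multiset.toFinsupp ((List.ofFn a.2.1 :
    List (Fin N)) : Multiset (Fin N)))) hq0
  -- Only the index `a` contributes to this monomial; its coefficient is `w j a` times a power of
  -- `i`, which is nonzero.
  rw [hq, MvPolynomial.coeff_sum, Finset.sum_eq_single a, MvPolynomial.coeff_monomial, if_pos rfl,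
    MvPolynomial.coeff_zero] at h1
  · simpa using h1
  · intro b _ hb
    rw [MvPolynomial.coeff_monomial, if_neg fun h => hb (toFinsupp_ofFn_injective h)]
  · simp
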